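/- Fix an integer $n\ge 0$ and $\lambda\in\mathbb R$, and put $\mathcal H=L^2(\mathbb R^{2n+1})$, the space of square-integrable functions of $(x,y,r)$ with $x,y\in\mathbb R^n$, $r\in\mathbb R$ (Lebesgue measure); identify $\mathcal H\otimes\mathcal H$ with $L^2(\mathbb R^{2n+1}\times\mathbb R^{2n+1})$. Write $e(t)=e^{2\pi i t}$, $\bar e(t)=e^{-2\pi i t}$, $\beta(x,y)=x\cdot y$, and $\eta_\lambda(r)=\frac{e^{2\lambda r}-1}{2\lambda}$ for $\lambda\neq 0$, $\eta_0(r)=r$. Let $U_A$ be the operator on $\mathcal H\otimes\mathcal H$ $$U_A\xi(x,y,r;x',y',r')=(e^{-\lambda r'})^n\,\bar e\bigl[\eta_\lambda(r')\beta(e^{-\lambda r'}x,\,y'-e^{-\lambda r'}y)\bigr]\;\xi(e^{-\lambda r'}x,e^{-\lambda r'}y,r+r';\,x'-e^{-\lambda r'}x,y'-e^{-\lambda r'}y,r'),$$ let $j$ be the operator on $\mathcal H$ $$j\xi(x,y,r)=(e^{\lambda r})^n\,\bar e[\eta_\lambda(r)\beta(x,y)]\;\xi(-e^{\lambda r}x,-e^{\lambda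 r}y,-r),$$ and let $\Sigma$ be the flip on $\mathcal H\otimes\mathcal H$. Put $$\widehat{U_A}=\Sigma(j\otimes1)U_A(j\otimes1)\Sigma,\quad X=\Sigma\widehat{U_A}^{*}\Sigma,\quad Y=\Sigma X^*\Sigma=\widehat{U_A},\quad Z=Y^*(j\otimes j)Y(j\otimes j),$$ and, in leg-numbering notation on $\mathcal H\otimes\mathcal H\otimes\mathcal H\otimes\mathcal H$, $V_D=Z_{12}Y_{24}Z_{12}^*X_{13}$. With $\mathcal B(\cdot)_*$ denoting the normal functionals, define the norm closures $$A=\overline{\{(\omega\otimes\mathrm{id})(U_A):\omega\in\mathcal B(\mathcal H)_*\}},\qquad \hat A^{\rm op}=\overline{\{(\mathrm{id}\otimes\omega)(X):\omega\in\mathcal B(\mathcal H)_*\}}\qquad\text{in }\mathcal B(\mathcal H),$$ $$\widehat{A_D}=\overline{\{(\Omega\otimes\mathrm{id}\otimes\mathrm{id})(V_D):\Omega\in\mathcal B(\mathcal H\otimes\mathcal H)_*\}}\qquad\text{in }\mathcal B(\mathcal H\otimes\mathcal H).$$ Then $A$, $\hat A^{\rm op}$ and $\widehat{A_D}$ are $C^*$-algebras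 (norm-closed $*$-subalgebras of $\mathcal B(\mathcal H)$, $\mathcal B(\mathcal H)$ and $\mathcal B(\mathcal H\otimes\mathcal H)$, respectively), and $$\widehat{A_D}=A\otimes\hat A^{\rm op},$$ where the right-hand side is the spatial tensor product, i.e. the norm closure in $\mathcal B(\mathcal H\otimes\mathcal H)$ of the linear span of $\{a\otimes b: a\in A,\ b\in\hat A^{\rm op}\}$. -/

import Mathlib

set_option linter.unusedSectionVars false
set_option synthInstance.maxSize 4000

namespace QDouble

noncomputable section

open MeasureTheory
open scoped InnerProductSpace TensorProduct ENNReal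

/-- The Hilbert space `L²(X)`; `L²(X × Y)` plays the role of the Hilbert space tensor product
`L²(X) ⊗ L²(Y)`. -/
abbrev L2 (X : Type*) [MeasureSpace X] : Type _ := Lp ℂ 2 (volume : Measure X)

/-- The algebra `B(L²(X))` of bounded operators, with the operator norm. -/
abbrev Op (X : Type*) [MeasureSpace X] : Type _ := L2 X →L[ℂ] L2 X

section Tensor

variable {X Y : Type*} [MeasureSpace X] [MeasureSpace Y]
  [SigmaFinite (volume : Measure X)] [SigmaFinite (volume : Measure Y)]

theorem memLp_tmul (f : L2 X) (g : L2 Y) :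
    MemLp (fun p : X × Y => f p.1 * g p.2) 2 (volume : Measure (X × Y)) := by
  have hf := Lp.aestronglyMeasurable f
  have hg := Lp.aestronglyMeasurable g
  have hm : AEStronglyMeasurable (fun p : X × Y => f p.1 * g p.2) (volume : Measure (X × Y)) :=
    hf.comp_fst.mul hg.comp_snd
  rw [memLp_two_iff_integrable_sq_norm hm]
  have h1 := (memLp_two_iff_integrable_sq_norm hf).1 (Lp.memLp f)
  have h2 := (memLp_two_iff_integrable_sq_norm hg).1 (Lp.memLp g)
  refine (h1.mul_prod h2).congr ?_
  exact .of_forall fun p => by simp [mul_pow]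

/-- The elementary tensor `f ⊗ g`, that is the function `(x, y) ↦ f x * g y`. -/
def tmul (f : L2 X) (g : L2 Y) : L2 (X × Y) := (memLp_tmul f g).toLp _

theorem coeFn_tmul (f : L2 X) (g : L2 Y) :
    tmul f g =ᵐ[volume] fun p : X × Y => f p.1 * g p.2 := MemLp.coeFn_toLp _

theorem ae_fst {P : X → Prop} (h : ∀ᵐ x, P x) : ∀ᵐ p : X × Y, P p.1 :=
  Measure.quasiMeasurePreserving_fst.ae h

theorem ae_snd {P : Y → Prop} (h : ∀ᵐ y, P y) : ∀ᵐ p : X × Y, P p.2 :=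
  Measure.quasiMeasurePreserving_snd.ae h

/-- The bilinear map `(f, g) ↦ f ⊗ g`. -/
def tmulBilin : L2 X →ₗ[ℂ] L2 Y →ₗ[ℂ] L2 (X × Y) :=
  LinearMap.mk₂ ℂ tmul
    (fun f f' g => by
      apply Lp.ext
      filter_upwards [coeFn_tmul (f + f') g, coeFn_tmul f g, coeFn_tmul f' g,
        Lp.coeFn_add (tmul f g) (tmul f' g), ae_fst (Y := Y) (Lp.coeFn_add f f')]
        with p h1 h2 h3 h4 h5
      simp only [Pi.add_apply] at h4 h5
      rw [h1, h4, h2, h3, h5]; ring)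
    (fun c f g => by
      apply Lp.ext
      filter_upwards [coeFn_tmul (c • f) g, coeFn_tmul f g,
        Lp.coeFn_smul c (tmul f g), ae_fst (Y := Y) (Lp.coeFn_smul c f)]
        with p h1 h2 h4 h5
      simp only [Pi.smul_apply, smul_eq_mul] at h4 h5
      rw [h1, h4, h2, h5]; ring)
    (fun f g g' => by
      apply Lp.ext
      filter_upwards [coeFn_tmul f (g + g'), coeFn_tmul f g, coeFn_tmul f g',
        Lp.coeFn_add (tmul f g) (tmul f g'), ae_snd (X := X) (Lp.coeFn_add g g')]
        with p h1 h2 h3 h4 h5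
      simp only [Pi.add_apply] at h4 h5
      rw [h1, h4, h2, h3, h5]; ring)
    (fun c f g => by
      apply Lp.ext
      filter_upwards [coeFn_tmul f (c • g), coeFn_tmul f g,
        Lp.coeFn_smul c (tmul f g), ae_snd (X := X) (Lp.coeFn_smul c g)]
        with p h1 h2 h4 h5
      simp only [Pi.smul_apply, smul_eq_mul] at h4 h5
      rw [h1, h4, h2, h5]; ring)

theorem inner_tmul_tmul (f f' : L2 X) (g g' : L2 Y) :
    ⟪tmul f g, tmul f' g'⟫_ℂ = ⟪f, f'⟫_ℂ * ⟪g, g'⟫_ℂ := by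
  rw [L2.inner_def, L2.inner_def, L2.inner_def, ← integral_prod_mul]
  refine integral_congr_ae ?_
  filter_upwards [coeFn_tmul f g, coeFn_tmul f' g'] with p h1 h2
  rw [h1, h2]
  simp only [RCLike.inner_apply, map_mul]
  ring

/-- The isometric inclusion of the algebraic tensor product `L²(X) ⊗ L²(Y)` in `L²(X × Y)`. -/
def tensorIncl : (L2 X ⊗[ℂ] L2 Y) →ₗᵢ[ℂ] L2 (X × Y) :=
  LinearMap.isometryOfInner (TensorProduct.lift (tmulBilin (X := X) (Y := Y))) (by
    intro x y
    induction x using TensorProduct.induction_on with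
    | zero => simp
    | add a b ha hb => simp only [map_add, inner_add_left, ha, hb]
    | tmul f g =>
      induction y using TensorProduct.induction_on with
      | zero => simp
      | add a b ha hb => simp only [map_add, inner_add_right, ha, hb]
      | tmul f' g' =>
        simp only [TensorProduct.lift.tmul, TensorProduct.inner_tmul]
        exact inner_tmul_tmul f f' g g')

theorem tensorIncl_tmul (f : L2 X) (g : L2 Y) : tensorIncl (f ⊗ₜ[ℂ] g) = tmul f g := rfl

theorem eq_zero_of_rect (h : L2 (X × Y))
    (H : ∀ (s : Set X) (t : Set Y), MeasurableSet s → MeasurableSet t → volume s < ∞ →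
      volume t < ∞ → ∫ p in s ×ˢ t, h p = 0) : h = 0 := by
  let A : ℕ → Set (X × Y) := fun k =>
    spanningSets (volume : Measure X) k ×ˢ spanningSets (volume : Measure Y) k
  have hAm : ∀ k, MeasurableSet (A k) := fun k =>
    (measurableSet_spanningSets _ k).prod (measurableSet_spanningSets _ k)
  have hAf : ∀ k, volume (A k) < ∞ := fun k => by
    rw [Measure.volume_eq_prod, Measure.prod_prod]
    exact ENNReal.mul_lt_top (measure_spanningSets_lt_top _ k) (measure_spanningSets_lt_top _ k)
  have hAu : ⋃ k, A k = Set.univ := by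
    rw [Set.eq_univ_iff_forall]
    rintro ⟨x, y⟩
    have hx := Set.mem_univ x
    have hy := Set.mem_univ y
    rw [← iUnion_spanningSets (volume : Measure X), Set.mem_iUnion] at hx
    rw [← iUnion_spanningSets (volume : Measure Y), Set.mem_iUnion] at hy
    obtain ⟨i, hi⟩ := hx
    obtain ⟨j, hj⟩ := hy
    exact Set.mem_iUnion.2 ⟨max i j, monotone_spanningSets _ (le_max_left i j) hi,
      monotone_spanningSets _ (le_max_right i j) hj⟩
  have hint : ∀ k, Integrable h (volume.restrict (A k)) := fun k => by
    have : IsFiniteMeasure ((volume : Measure (X × Y)).restrict (A k)) :=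
      ⟨by rw [Measure.restrict_apply_univ]; exact hAf k⟩
    exact ((Lp.memLp h).restrict (A k)).integrable (by norm_num)
  have key : ∀ k, ∀ᵐ p ∂(volume.restrict (A k)), h p = 0 := by
    intro k
    refine Integrable.ae_eq_zero_of_forall_setIntegral_eq_zero (hint k) ?_
    intro E hE _
    induction E, hE using MeasurableSpace.induction_on_inter
      (generateFrom_prod (α := X) (β := Y)).symm isPiSystem_prod with
    | empty => simp
    | basic E hE =>
      obtain ⟨s, hs, t, ht, rfl⟩ := hE
      rw [Measure.restrict_restrict (hs.prod ht), Set.prod_inter_prod]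
      exact H _ _ (MeasurableSet.inter hs (measurableSet_spanningSets _ k))
        (MeasurableSet.inter ht (measurableSet_spanningSets _ k))
        ((measure_mono Set.inter_subset_right).trans_lt (measure_spanningSets_lt_top _ k))
        ((measure_mono Set.inter_subset_right).trans_lt (measure_spanningSets_lt_top _ k))
    | compl E hE ih =>
      rw [setIntegral_compl hE (hint k), ih ((measure_lt_top_of_subset (Set.subset_univ E)
        (by rw [Measure.restrict_apply_univ]; exact (hAf k).ne)))]
      simpa using H _ _ (measurableSet_spanningSets _ k) (measurableSet_spanningSets _ k)
        (measure_spanningSets_lt_top _ k) (measure_spanningSets_lt_top _ k)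
    | iUnion f hd hf ih =>
      rw [integral_iUnion hf hd (hint k).integrableOn]
      have : ∀ i, ∫ p in f i, h p ∂(volume.restrict (A k)) = 0 := fun i =>
        ih i (measure_lt_top_of_subset (Set.subset_univ _)
          (by rw [Measure.restrict_apply_univ]; exact (hAf k).ne))
      simp [this]
  have : ∀ᵐ p ∂(volume : Measure (X × Y)), h p = 0 := by
    have h2 := (ae_restrict_iUnion_iff A _).2 key
    rwa [hAu, Measure.restrict_univ] at h2
  apply Lp.ext
  filter_upwards [this, Lp.coeFn_zero ℂ 2 (volume : Measure (X × Y))] with p h1 h2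
  rw [h1, h2]; rfl

theorem denseRange_tensorIncl : DenseRange (tensorIncl (X := X) (Y := Y)) := by
  have : (LinearMap.range (tensorIncl (X := X) (Y := Y)).toLinearMap).topologicalClosure = ⊤ := by
    rw [Submodule.topologicalClosure_eq_top_iff, Submodule.eq_bot_iff]
    intro h hh
    refine eq_zero_of_rect h fun s t hs ht hsf htf => ?_
    have h0 := hh _ ⟨indicatorConstLp 2 hs hsf.ne (1 : ℂ) ⊗ₜ[ℂ]
      indicatorConstLp 2 ht htf.ne (1 : ℂ), rfl⟩
    have hst : volume (s ×ˢ t) ≠ ∞ := by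
      rw [Measure.volume_eq_prod, Measure.prod_prod]
      exact (ENNReal.mul_lt_top hsf htf).ne
    have h1 : tmul (indicatorConstLp 2 hs hsf.ne (1 : ℂ)) (indicatorConstLp 2 ht htf.ne (1 : ℂ)) =
        indicatorConstLp 2 (hs.prod ht) hst (1 : ℂ) := by
      apply Lp.ext
      filter_upwards [coeFn_tmul (indicatorConstLp 2 hs hsf.ne (1 : ℂ))
          (indicatorConstLp 2 ht htf.ne (1 : ℂ)),
        indicatorConstLp_coeFn (p := 2) (hs := hs.prod ht) (hμs := hst) (c := (1 : ℂ)),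
        ae_fst (Y := Y) (indicatorConstLp_coeFn (p := 2) (hs := hs) (hμs := hsf.ne) (c := (1 : ℂ))),
        ae_snd (X := X) (indicatorConstLp_coeFn (p := 2) (hs := ht) (hμs := htf.ne) (c := (1 : ℂ)))]
        with p h1 h2 h3 h4
      rw [h1, h2, h3, h4]
      by_cases a : p.1 ∈ s <;> by_cases b : p.2 ∈ t <;> simp [Set.indicator, a, b]
    change ⟪tmul _ _, h⟫_ℂ = 0 at h0
    rw [h1, L2.inner_indicatorConstLp_one] at h0
    exact h0
  intro x
  have hx : x ∈ ((LinearMap.range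
      (tensorIncl (X := X) (Y := Y)).toLinearMap).topologicalClosure : Set (L2 (X × Y))) := by
    rw [this]; exact Set.mem_univ x
  rw [Submodule.topologicalClosure_coe] at hx
  exact hx

/-- `tensorIncl` as a bounded operator. -/
def tensorInclL : (L2 X ⊗[ℂ] L2 Y) →L[ℂ] L2 (X × Y) := tensorIncl.toContinuousLinearMap

theorem tensorInclL_tmul (f : L2 X) (g : L2 Y) : tensorInclL (f ⊗ₜ[ℂ] g) = tmul f g := rfl

/-- The operator `S ⊗ T` on `L²(X × Y)`: the bounded extension of the algebraic tensor product
of `S` and `T`. -/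
def opTensor (S : Op X) (T : Op Y) : Op (X × Y) :=
  (tensorInclL ∘L TensorProduct.mapL S T).extend tensorInclL

theorem opTensor_tmul (S : Op X) (T : Op Y) (f : L2 X) (g : L2 Y) :
    opTensor S T (tmul f g) = tmul (S f) (T g) := by
  have h := ContinuousLinearMap.extend_eq (e := tensorInclL (X := X) (Y := Y))
    (tensorInclL ∘L TensorProduct.mapL S T) denseRange_tensorIncl
    (tensorIncl (X := X) (Y := Y)).isometry.isUniformInducing (f ⊗ₜ[ℂ] g)
  rw [tensorInclL_tmul, ContinuousLinearMap.comp_apply, TensorProduct.mapL_tmul,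
    tensorInclL_tmul] at h
  exact h

end Tensor

section Slices

/-- A normal functional on `B(H)`, presented as `T ↦ ∑ₖ ⟨T ξₖ, ηₖ⟩` with square-summable
sequences of vectors; every element of the predual of `B(H)` has this form. -/
structure NormalFunctional (H : Type*) [NormedAddCommGroup H] [InnerProductSpace ℂ H] where
  ξ : ℕ → H
  η : ℕ → H
  summable_ξ : Summable fun k => ‖ξ k‖ ^ 2
  summable_η : Summable fun k => ‖η k‖ ^ 2

/-- The value of a normal functional on an operator. -/
def NormalFunctional.eval {H : Type*} [NormedAddCommGroup H] [InnerProductSpace ℂ H]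
    (ω : NormalFunctional H) (T : H →L[ℂ] H) : ℂ :=
  ∑' k, ⟪ω.η k, T (ω.ξ k)⟫_ℂ

variable {X Y : Type*} [MeasureSpace X] [MeasureSpace Y]
  [SigmaFinite (volume : Measure X)] [SigmaFinite (volume : Measure Y)]

/-- The bounded operator `g ↦ f ⊗ g`. -/
def tmulLeft (f : L2 X) : L2 Y →L[ℂ] L2 (X × Y) :=
  tensorInclL ∘L TensorProduct.mkL ℂ (L2 X) (L2 Y) f

/-- The bounded operator `f ↦ f ⊗ g`. -/
def tmulRight (g : L2 Y) : L2 X →L[ℂ] L2 (X × Y) :=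
  tensorInclL ∘L (TensorProduct.mkL ℂ (L2 X) (L2 Y)).flip g

theorem tmulLeft_apply (f : L2 X) (g : L2 Y) : tmulLeft f g = tmul f g := rfl

theorem tmulRight_apply (f : L2 X) (g : L2 Y) : tmulRight g f = tmul f g := rfl

theorem norm_tmul (f : L2 X) (g : L2 Y) : ‖tmul f g‖ = ‖f‖ * ‖g‖ := by
  rw [← tensorIncl_tmul, LinearIsometry.norm_map, TensorProduct.norm_tmul]

theorem norm_tmulLeft_le (f : L2 X) : ‖(tmulLeft f : L2 Y →L[ℂ] L2 (X × Y))‖ ≤ ‖f‖ :=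
  ContinuousLinearMap.opNorm_le_bound _ (norm_nonneg _) fun g => by
    rw [tmulLeft_apply, norm_tmul]

theorem norm_tmulRight_le (g : L2 Y) : ‖(tmulRight g : L2 X →L[ℂ] L2 (X × Y))‖ ≤ ‖g‖ :=
  ContinuousLinearMap.opNorm_le_bound _ (norm_nonneg _) fun f => by
    rw [tmulRight_apply, norm_tmul, mul_comm]

/-- The left slice `(ω ⊗ id)(T)`. -/
def leftSlice (ω : NormalFunctional (L2 X)) (T : Op (X × Y)) : Op Y :=
  ∑' k, ContinuousLinearMap.adjoint (tmulLeft (ω.η k)) ∘L T ∘L tmulLeft (ω.ξ k)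

/-- The right slice `(id ⊗ ω)(T)`. -/
def rightSlice (ω : NormalFunctional (L2 Y)) (T : Op (X × Y)) : Op X :=
  ∑' k, ContinuousLinearMap.adjoint (tmulRight (ω.η k)) ∘L T ∘L tmulRight (ω.ξ k)

theorem summable_sandwich {H K : Type*} [NormedAddCommGroup H] [InnerProductSpace ℂ H]
    [CompleteSpace H] [NormedAddCommGroup K] [InnerProductSpace ℂ K] [CompleteSpace K]
    (T : K →L[ℂ] K) (P Q : ℕ → H →L[ℂ] K) (a b : ℕ → ℝ) (ha : Summable fun k => a k ^ 2)
    (hb : Summable fun k => b k ^ 2) (hP : ∀ k, ‖P k‖ ≤ a k) (hQ : ∀ k, ‖Q k‖ ≤ b k) :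
    Summable fun k => ContinuousLinearMap.adjoint (Q k) ∘L T ∘L P k := by
  refine Summable.of_norm_bounded ((ha.add hb).mul_left ‖T‖) fun k => ?_
  have h1 := ContinuousLinearMap.opNorm_comp_le (ContinuousLinearMap.adjoint (Q k)) (T ∘L P k)
  have h2 := ContinuousLinearMap.opNorm_comp_le T (P k)
  rw [LinearIsometryEquiv.norm_map] at h1
  have h3 : ‖Q k‖ * ‖T ∘L P k‖ ≤ b k * (‖T‖ * a k) :=
    mul_le_mul (hQ k) (h2.trans (mul_le_mul_of_nonneg_left (hP k) (norm_nonneg _)))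
      (norm_nonneg _) ((norm_nonneg _).trans (hQ k))
  have h4 : b k * a k ≤ a k ^ 2 + b k ^ 2 := by
    nlinarith [sq_nonneg (a k - b k), sq_nonneg (a k), sq_nonneg (b k)]
  calc _ ≤ b k * (‖T‖ * a k) := h1.trans h3
    _ = ‖T‖ * (b k * a k) := by ring
    _ ≤ _ := mul_le_mul_of_nonneg_left h4 (norm_nonneg _)

theorem hasSum_leftSlice (ω : NormalFunctional (L2 X)) (T : Op (X × Y)) :
    HasSum (fun k => ContinuousLinearMap.adjoint (tmulLeft (ω.η k)) ∘L T ∘L tmulLeft (ω.ξ k))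
      (leftSlice ω T) :=
  (summable_sandwich T _ _ _ _ ω.summable_ξ ω.summable_η (fun _ => norm_tmulLeft_le _)
    (fun _ => norm_tmulLeft_le _)).hasSum

theorem hasSum_rightSlice (ω : NormalFunctional (L2 Y)) (T : Op (X × Y)) :
    HasSum (fun k => ContinuousLinearMap.adjoint (tmulRight (ω.η k)) ∘L T ∘L tmulRight (ω.ξ k))
      (rightSlice ω T) :=
  (summable_sandwich T _ _ _ _ ω.summable_ξ ω.summable_η (fun _ => norm_tmulRight_le _)
    (fun _ => norm_tmulRight_le _)).hasSum

/-- The norm closure of the set of left slices of `T`. -/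
def leftSliceClosure (T : Op (X × Y)) : Set (Op Y) :=
  closure (Set.range fun ω : NormalFunctional (L2 X) => leftSlice ω T)

/-- The norm closure of the set of right slices of `T`. -/
def rightSliceClosure (T : Op (X × Y)) : Set (Op X) :=
  closure (Set.range fun ω : NormalFunctional (L2 Y) => rightSlice ω T)

/-- The spatial tensor product of two sets of operators: the norm closure in `B(L²(X × Y))` of
the linear span of the operators `a ⊗ b`. -/
def spatialTensor (A : Set (Op X)) (B : Set (Op Y)) : Set (Op (X × Y)) :=
  closure (Submodule.span ℂ {T | ∃ a ∈ A, ∃ b ∈ B, T = opTensor a b} : Set (Op (X × Y)))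

end Slices

/-- `A` is a concrete C*-algebra: a norm-closed `*`-subalgebra (not necessarily unital) of the
bounded operators. -/
def IsConcreteCStarAlgebra {X : Type*} [MeasureSpace X] (A : Set (Op X)) : Prop :=
  IsClosed A ∧ ∃ S : NonUnitalStarSubalgebra ℂ (Op X), (S : Set (Op X)) = A

section WeightedComposition

variable {X : Type*} [MeasureSpace X]

/-- The data `(φ, w)` for which `ξ ↦ w · (ξ ∘ φ)` is isometric on `L²(X)`. -/
structure IsWeightedComp (φ : X → X) (w : X → ℂ) : Prop where
  measurable_map : Measurable φ
  measurable_weight : Measurable w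
  lintegral_eq : ∀ f : X → ℝ≥0∞, Measurable f → ∫⁻ x, ‖w x‖ₑ ^ 2 * f (φ x) = ∫⁻ x, f x

namespace IsWeightedComp

variable {φ : X → X} {w : X → ℂ}

theorem ae_comp (h : IsWeightedComp φ w) {P : X → Prop} (hP : ∀ᵐ x, P x) : ∀ᵐ x, w x = 0 ∨ P (φ x) := by
  obtain ⟨t, hts, ht, ht0⟩ := exists_measurable_superset_of_null (ae_iff.1 hP)
  have h1 := h.lintegral_eq (t.indicator 1) (measurable_one.indicator ht)
  rw [lintegral_indicator_one ht, ht0, lintegral_eq_zero_iff] at h1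
  · filter_upwards [h1] with x hx
    by_contra! hc
    have : φ x ∈ t := hts hc.2
    simp [this, hc.1] at hx
  · exact (h.measurable_weight.enorm.pow_const 2).mul
      ((measurable_one.indicator ht).comp h.measurable_map)

theorem congr (h : IsWeightedComp φ w) {f g : X → ℂ} (hfg : f =ᵐ[volume] g) :
    (fun x => w x * f (φ x)) =ᵐ[volume] fun x => w x * g (φ x) := by
  filter_upwards [h.ae_comp hfg] with x hx
  rcases hx with hx | hx <;> simp [hx]

theorem eLpNorm_eq (h : IsWeightedComp φ w) (f : L2 X) :
    eLpNorm (fun x => w x * f (φ x)) 2 volume = eLpNorm f 2 volume := by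
  have hm : Measurable f := (Lp.stronglyMeasurable f).measurable
  rw [eLpNorm_eq_lintegral_rpow_enorm_toReal (by norm_num) (by norm_num),
    eLpNorm_eq_lintegral_rpow_enorm_toReal (by norm_num) (by norm_num)]
  congr 1
  have := h.lintegral_eq (fun x => ‖f x‖ₑ ^ 2) (hm.enorm.pow_const 2)
  simpa [mul_pow] using this

theorem memLp (h : IsWeightedComp φ w) (f : L2 X) : MemLp (fun x => w x * f (φ x)) 2 volume := by
  have hm : Measurable f := (Lp.stronglyMeasurable f).measurable
  refine ⟨(h.measurable_weight.mul (hm.comp h.measurable_map)).aestronglyMeasurable, ?_⟩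
  rw [h.eLpNorm_eq]
  exact Lp.eLpNorm_lt_top f

end IsWeightedComp

/-- The isometry `(T ξ)(x) = w(x) ξ(φ(x))` of `L²(X)`. -/
def weightedComp (φ : X → X) (w : X → ℂ) (h : IsWeightedComp φ w) : L2 X →ₗᵢ[ℂ] L2 X where
  toFun f := (h.memLp f).toLp _
  map_add' f g := by
    rw [← MemLp.toLp_add, MemLp.toLp_eq_toLp_iff]
    refine (h.congr (Lp.coeFn_add f g)).trans (.of_forall fun x => ?_)
    simp [mul_add]
  map_smul' c f := by
    rw [RingHom.id_apply, ← MemLp.toLp_const_smul, MemLp.toLp_eq_toLp_iff]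
    refine (h.congr (Lp.coeFn_smul c f)).trans (.of_forall fun x => ?_)
    simp only [Pi.smul_apply, smul_eq_mul]
    ring
  norm_map' f := by
    change ‖(h.memLp f).toLp (fun x => w x * f (φ x))‖ = ‖f‖
    rw [Lp.norm_toLp, h.eLpNorm_eq, Lp.norm_def]

theorem coeFn_weightedComp (φ : X → X) (w : X → ℂ) (h : IsWeightedComp φ w) (f : L2 X) :
    weightedComp φ w h f =ᵐ[volume] fun x => w x * f (φ x) :=
  MemLp.coeFn_toLp (h.memLp f)

end WeightedComposition

section Flips

variable {X Y : Type*} [MeasureSpace X] [MeasureSpace Y]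
  [SigmaFinite (volume : Measure X)] [SigmaFinite (volume : Measure Y)]

/-- The flip `Σ` on `L²(X × X)`. -/
def flipOp : Op (X × X) :=
  (Lp.compMeasurePreservingₗᵢ ℂ Prod.swap
    (Measure.measurePreserving_swap (μ := (volume : Measure X)) (ν := (volume : Measure X)))
    ).toContinuousLinearMap

/-- The exchange of the second and the third variable. -/
def midSwap (p : (X × X) × (X × X)) : (X × X) × (X × X) := ((p.1.1, p.2.1), (p.1.2, p.2.2))

theorem measurePreserving_midSwap :
    MeasurePreserving (midSwap (X := X)) volume volume := by
  have h1 : MeasurePreserving (fun p : X × (X × X) => (p.2.1, (p.1, p.2.2))) volume volume := by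
    have a := measurePreserving_prodAssoc
      (volume : Measure X) (volume : Measure X) (volume : Measure X)
    have b : MeasurePreserving (Prod.map Prod.swap id : (X × X) × X → (X × X) × X)
        volume volume :=
      Measure.measurePreserving_swap.prod (MeasurePreserving.id _)
    exact a.comp (b.comp a.symm)
  have a := measurePreserving_prodAssoc
    (volume : Measure X) (volume : Measure X) (volume : Measure (X × X))
  have b : MeasurePreserving (Prod.map id (fun p : X × (X × X) => (p.2.1, (p.1, p.2.2))))
      volume volume :=
    (MeasurePreserving.id (volume : Measure X)).prod h1
  exact a.symm.comp (b.comp a)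

/-- The flip `Σ₂₃` of the second and the third leg on `L²(X⁴)`. -/
def midFlipOp : Op ((X × X) × (X × X)) :=
  (Lp.compMeasurePreservingₗᵢ ℂ midSwap measurePreserving_midSwap).toContinuousLinearMap

/-- The operator `T₁₂`. -/
def leg12 (T : Op (X × X)) : Op ((X × X) × (X × X)) := opTensor T 1

/-- The operator `T₁₃ = Σ₂₃ T₁₂ Σ₂₃`. -/
def leg13 (T : Op (X × X)) : Op ((X × X) × (X × X)) := midFlipOp * opTensor T 1 * midFlipOp

/-- The operator `T₂₄ = Σ₂₃ T₃₄ Σ₂₃`. -/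
def leg24 (T : Op (X × X)) : Op ((X × X) × (X × X)) := midFlipOp * opTensor 1 T * midFlipOp

end Flips

section QuantumHeisenberg

/-- The space `H/Z × H^*/Z^⊥` with Lebesgue measure, for the `(2n+1)`-dimensional Heisenberg
group, with points `((x, y), r)`, `x, y ∈ ℝⁿ`, `r ∈ ℝ`. -/
abbrev Pt (n : ℕ) : Type :=
  (EuclideanSpace ℝ (Fin n) × EuclideanSpace ℝ (Fin n)) × ℝ

/-- The character `e(t) = exp(2πit)`. -/
def e (t : ℝ) : ℂ := Complex.exp (2 * Real.pi * t * Complex.I)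

/-- `η_λ(r) = (e^{2λr} - 1) / (2λ)`, with `η_0(r) = r`. -/
def eta (lam r : ℝ) : ℝ :=
  if lam = 0 then r else (Real.exp (2 * lam * r) - 1) / (2 * lam)

theorem norm_e (t : ℝ) : ‖e t‖ = 1 := by
  rw [e, show (2 * Real.pi * t * Complex.I : ℂ) = ((2 * Real.pi * t : ℝ) : ℂ) * Complex.I by
    push_cast; ring]
  exact Complex.norm_exp_ofReal_mul_I _

theorem measurable_e : Measurable e := by unfold e; fun_prop

theorem measurable_eta (lam : ℝ) : Measurable (eta lam) := by
  unfold eta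
  split_ifs <;> fun_prop

variable (n : ℕ) (lam : ℝ)

/-- The change of variables in the definition of `U_A`:
`(v, r; v', r') ↦ (e^{-λr'} v, r + r'; v' - e^{-λr'} v, r')`, where `v = (x, y)`. -/
def mapUA (p : Pt n × Pt n) : Pt n × Pt n :=
  ((Real.exp (-lam * p.2.2) • p.1.1, p.1.2 + p.2.2),
    (p.2.1 - Real.exp (-lam * p.2.2) • p.1.1, p.2.2))

/-- The weight in the definition of `U_A`:
`(e^{-λr'})ⁿ ē[η_λ(r') β(e^{-λr'} x, y' - e^{-λr'} y)]`. -/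
def weightUA (p : Pt n × Pt n) : ℂ :=
  ((Real.exp (-lam * p.2.2) ^ n : ℝ) : ℂ) *
    e (-(eta lam p.2.2 * inner ℝ (Real.exp (-lam * p.2.2) • p.1.1.1)
      (p.2.1.2 - Real.exp (-lam * p.2.2) • p.1.1.2)))

theorem lintegral_dilate (c : ℝ) (hc : 0 < c)
    (f : EuclideanSpace ℝ (Fin n) × EuclideanSpace ℝ (Fin n) → ℝ≥0∞) (hf : Measurable f) :
    ∫⁻ v, ENNReal.ofReal (c ^ n) ^ 2 * f (c • v) = ∫⁻ v, f v := by
  have : Measure.IsAddHaarMeasure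
      (volume : Measure (EuclideanSpace ℝ (Fin n) × EuclideanSpace ℝ (Fin n))) :=
    Measure.prod.instIsAddHaarMeasure _ _
  have h := Measure.map_addHaar_smul
    (volume : Measure (EuclideanSpace ℝ (Fin n) × EuclideanSpace ℝ (Fin n))) hc.ne'
  have h2 : ∫⁻ v, f (c • v) = ENNReal.ofReal |(c ^ (n + n))⁻¹| * ∫⁻ v, f v := by
    rw [← lintegral_map hf (measurable_const_smul c), h, lintegral_smul_measure]
    simp
  rw [lintegral_const_mul _ (by fun_prop), h2, ← mul_assoc, ← ENNReal.ofReal_pow (by positivity),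
    ← ENNReal.ofReal_mul (by positivity), abs_of_pos (by positivity)]
  rw [show (c ^ n) ^ 2 * (c ^ (n + n))⁻¹ = 1 by field_simp; ring]
  simp

theorem lintegral_reflect
    (f : EuclideanSpace ℝ (Fin n) × EuclideanSpace ℝ (Fin n) → ℝ≥0∞) :
    ∫⁻ v, f (-v) = ∫⁻ v, f v := by
  have : Measure.IsAddHaarMeasure
      (volume : Measure (EuclideanSpace ℝ (Fin n) × EuclideanSpace ℝ (Fin n))) :=
    Measure.prod.instIsAddHaarMeasure _ _
  exact lintegral_neg_eq_self f

theorem lintegral_translate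
    (f : EuclideanSpace ℝ (Fin n) × EuclideanSpace ℝ (Fin n) → ℝ≥0∞)
    (u : EuclideanSpace ℝ (Fin n) × EuclideanSpace ℝ (Fin n)) :
    ∫⁻ v, f (v - u) = ∫⁻ v, f v := by
  have : Measure.IsAddHaarMeasure
      (volume : Measure (EuclideanSpace ℝ (Fin n) × EuclideanSpace ℝ (Fin n))) :=
    Measure.prod.instIsAddHaarMeasure _ _
  exact lintegral_sub_right_eq_self f u

theorem measurable_mapUA : Measurable (mapUA n lam) := by unfold mapUA; fun_prop
theorem measurable_weightUA : Measurable (weightUA n lam) := by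
  unfold weightUA
  have := measurable_e
  have := measurable_eta lam
  fun_prop
theorem enorm_weightUA (p : Pt n × Pt n) :
    ‖weightUA n lam p‖ₑ = ENNReal.ofReal (Real.exp (-lam * p.2.2) ^ n) := by
  rw [← ofReal_norm, weightUA, norm_mul, norm_e, mul_one, Complex.norm_real,
    Real.norm_of_nonneg (by positivity)]

theorem isWeightedComp_UA : IsWeightedComp (mapUA n lam) (weightUA n lam) := by
  refine ⟨measurable_mapUA n lam, measurable_weightUA n lam, fun f hf => ?_⟩
  have := measurable_mapUA n lam
  have := measurable_weightUA n lam
  have step1 : ∀ q : Pt n, ∫⁻ p : Pt n, ‖weightUA n lam (p, q)‖ₑ ^ 2 * f (mapUA n lam (p, q)) =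
      ∫⁻ p : Pt n, f (p, (q.1 - p.1, q.2)) := by
    intro q
    rw [Measure.volume_eq_prod, lintegral_prod_symm _ (by fun_prop),
      lintegral_prod_symm _ (by fun_prop)]
    simp only [enorm_weightUA, mapUA]
    have h1 : ∀ r : ℝ, ∫⁻ v : EuclideanSpace ℝ (Fin n) × EuclideanSpace ℝ (Fin n),
        ENNReal.ofReal (Real.exp (-lam * q.2) ^ n) ^ 2 *
          f ((Real.exp (-lam * q.2) • v, r + q.2), (q.1 - Real.exp (-lam * q.2) • v, q.2)) =
        ∫⁻ v, f ((v, r + q.2), (q.1 - v, q.2)) := fun r =>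
      lintegral_dilate n (Real.exp (-lam * q.2)) (Real.exp_pos _)
        (fun v => f ((v, r + q.2), (q.1 - v, q.2))) (by fun_prop)
    simp only [h1]
    exact lintegral_add_right_eq_self (fun r => ∫⁻ v, f ((v, r), (q.1 - v, q.2))) q.2
  have step2 : ∀ p : Pt n, ∫⁻ q : Pt n, f (p, (q.1 - p.1, q.2)) = ∫⁻ q : Pt n, f (p, q) := by
    intro p
    rw [Measure.volume_eq_prod, lintegral_prod_symm _ (by fun_prop),
      lintegral_prod_symm _ (by fun_prop)]
    exact lintegral_congr fun r => lintegral_translate n (fun v => f (p, (v, r))) p.1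
  rw [Measure.volume_eq_prod, lintegral_prod_symm _ (by fun_prop)]
  simp only [step1]
  rw [lintegral_lintegral_swap (by fun_prop), lintegral_prod _ (by fun_prop)]
  exact lintegral_congr step2

/-- The multiplicative unitary `U_A` on `L²(Pt n × Pt n)`:
`U_A ξ(x, y, r; x', y', r') = (e^{-λr'})ⁿ ē[η_λ(r') β(e^{-λr'} x, y' - e^{-λr'} y)]`
`ξ(e^{-λr'} x, e^{-λr'} y, r + r'; x' - e^{-λr'} x, y' - e^{-λr'} y, r')`. -/
def UA : Op (Pt n × Pt n) :=
  (weightedComp (mapUA n lam) (weightUA n lam) (isWeightedComp_UA n lam)).toContinuousLinearMap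

theorem UA_apply (ξ : L2 (Pt n × Pt n)) :
    UA n lam ξ =ᵐ[volume] fun p => weightUA n lam p * ξ (mapUA n lam p) :=
  coeFn_weightedComp _ _ (isWeightedComp_UA n lam) ξ

/-- The change of variables `(v, r) ↦ (-e^{λr} v, -r)` in the definition of `j`. -/
def mapJ (p : Pt n) : Pt n := (-(Real.exp (lam * p.2) • p.1), -p.2)

/-- The weight `(e^{λr})ⁿ ē[η_λ(r) β(x, y)]` in the definition of `j`. -/
def weightJ (p : Pt n) : ℂ :=
  ((Real.exp (lam * p.2) ^ n : ℝ) : ℂ) * e (-(eta lam p.2 * inner ℝ p.1.1 p.1.2))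

theorem measurable_mapJ : Measurable (mapJ n lam) := by unfold mapJ; fun_prop
theorem measurable_weightJ : Measurable (weightJ n lam) := by
  unfold weightJ
  have := measurable_e
  have := measurable_eta lam
  fun_prop
theorem enorm_weightJ (p : Pt n) : ‖weightJ n lam p‖ₑ =
    ENNReal.ofReal (Real.exp (lam * p.2) ^ n) := by
  rw [← ofReal_norm, weightJ, norm_mul, norm_e, mul_one, Complex.norm_real,
    Real.norm_of_nonneg (by positivity)]

theorem isWeightedComp_J : IsWeightedComp (mapJ n lam) (weightJ n lam) := by
  refine ⟨measurable_mapJ n lam, measurable_weightJ n lam, fun f hf => ?_⟩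
  have := measurable_mapJ n lam
  have := measurable_weightJ n lam
  rw [Measure.volume_eq_prod, lintegral_prod_symm _ (by fun_prop),
    lintegral_prod_symm _ hf.aemeasurable]
  simp only [enorm_weightJ, mapJ]
  have h1 : ∀ r : ℝ, ∫⁻ v : EuclideanSpace ℝ (Fin n) × EuclideanSpace ℝ (Fin n),
      ENNReal.ofReal (Real.exp (lam * r) ^ n) ^ 2 * f (-(Real.exp (lam * r) • v), -r) =
      ∫⁻ v, f (v, -r) := fun r => by
    rw [lintegral_dilate n (Real.exp (lam * r)) (Real.exp_pos _) (fun v => f (-v, -r))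
      (by fun_prop), lintegral_reflect n (fun v => f (v, -r))]
  simp only [h1]
  exact lintegral_neg_eq_self (fun r => ∫⁻ v, f (v, r))

/-- The involutive unitary `j`:
`(jξ)(x, y, r) = (e^{λr})ⁿ ē[η_λ(r) β(x, y)] ξ(-e^{λr} x, -e^{λr} y, -r)`. -/
def opJ : Op (Pt n) :=
  (weightedComp (mapJ n lam) (weightJ n lam) (isWeightedComp_J n lam)).toContinuousLinearMap

theorem opJ_apply (ξ : L2 (Pt n)) :
    opJ n lam ξ =ᵐ[volume] fun p => weightJ n lam p * ξ (mapJ n lam p) :=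
  coeFn_weightedComp _ _ (isWeightedComp_J n lam) ξ

/-- `Û_A = Σ (j ⊗ 1) U_A (j ⊗ 1) Σ`. -/
def UAhat : Op (Pt n × Pt n) :=
  flipOp * opTensor (opJ n lam) 1 * UA n lam * opTensor (opJ n lam) 1 * flipOp

/-- `X = Σ Û_A^* Σ`. -/
def opX : Op (Pt n × Pt n) := flipOp * star (UAhat n lam) * flipOp

/-- `Y = Σ X^* Σ`, which is `Û_A`. -/
def opY : Op (Pt n × Pt n) := flipOp * star (opX n lam) * flipOp

/-- `Z = Y^* (j ⊗ j) Y (j ⊗ j)`. -/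
def opZ : Op (Pt n × Pt n) :=
  star (opY n lam) *
    (opTensor (opJ n lam) (opJ n lam) * opY n lam * opTensor (opJ n lam) (opJ n lam))

/-- `V_D = Z₁₂ Y₂₄ Z₁₂^* X₁₃`. -/
def VD : Op ((Pt n × Pt n) × (Pt n × Pt n)) :=
  leg12 (opZ n lam) * leg24 (opY n lam) * star (leg12 (opZ n lam)) * leg13 (opX n lam)

/-- The quantum Heisenberg group algebra `A`, the norm closure of the left slices of `U_A`. -/
def algA : Set (Op (Pt n)) := leftSliceClosure (UA n lam)

/-- The opposite dual `Â^op`, the norm closure of the right slices of `X`. -/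
def algAhatOp : Set (Op (Pt n)) := rightSliceClosure (opX n lam)

/-- The dual of the double, the norm closure of the left slices of `V_D`. -/
def algADhat : Set (Op (Pt n × Pt n)) := leftSliceClosure (VD n lam)

end QuantumHeisenberg

end

end QDouble

namespace QDouble

noncomputable section

open MeasureTheory ContinuousLinearMap
open scoped InnerProductSpace TensorProduct ENNReal

/-! ### Tensor products of vectors and of operators. -/

section TensorOperators

variable {X Y Z : Type*} [MeasureSpace X] [MeasureSpace Y] [MeasureSpace Z]
  [SigmaFinite (volume : Measure X)] [SigmaFinite (volume : Measure Y)]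
  [SigmaFinite (volume : Measure Z)]

/-! Two arguments are combined: the pentagon equation for the algebras, and a regularity property of
$Z$ for the tensor product formula. All the unitaries are weighted compositions $\xi\mapsto
w\cdot(\xi\circ\varphi)$, so operator identities among them become pointwise identities for
$\varphi$ and $w$. By density it is enough to slice with vector functionals $\langle g,\cdot
f\rangle$ (`leftSliceClosure_eq`).

Algebras. $X$ and $Y$ are isometries with $V_{12}V_{13}V_{23}=V_{23}V_{12}$. A product of two slices
of $V$ is a slice of $V_{13}V_{23}=V_{12}^*V_{23}V_{12}$; the outer factors only move the vectors,
so the product lies in the closed span of slices of $V$ (`vecSlice_mul_vecSlice`). The adjoint of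
the slice at $(g,f)$ is the slice at $(C\bar g,C\bar f)$ for an explicit isometry $C$
(`star_vecSlice_of_isWC`). Conjugating the sliced leg by $j$ only permutes vector functionals, and
passing to the adjoint is harmless, so $A$ is the slice algebra of $X$ and $\hat A^{\rm op}$ that of
$Y$ (`algA_eq`, `algAhatOp_eq`).

Double. The left factor $Z_{12}$ of $V_D$ is absorbed by the functional. What remains, sliced at
$(g\otimes g',f\otimes f')$, is the slice at $(g',f)$ of $Y_{13}R_1X_{12}$ with $R=(\langle
g|\otimes1)Z^*(1\otimes|f'\rangle)$ (`vecSlice_eq_bridge`). When $R$ has rank one this is an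
elementary tensor of a slice of $X$ and a slice of $Y$ (`bridge_hsOp_tmul`). The crux is that $R$ is
Hilbert–Schmidt with kernel $V(\bar g\otimes f')$ for a coisometry $V$ (`exists_slice_star_opZ`).
Hence the closed span of the $R$'s in Hilbert–Schmidt norm contains every rank-one operator and is
spanned by them; continuity in $R$ gives both inclusions (`leftSliceClosure_double`). -/

theorem tmul_induction {p : L2 (X × Y) → Prop} (hc : IsClosed {Θ | p Θ})
    (hadd : ∀ Θ Θ', p Θ → p Θ' → p (Θ + Θ')) (h : ∀ f g, p (tmul f g)) (Θ : L2 (X × Y)) : p Θ := by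
  refine denseRange_tensorIncl.induction_on (p := p) Θ hc fun t => ?_
  induction t using TensorProduct.induction_on with
  | zero =>
    have h0 := h (0 : L2 X) (0 : L2 Y)
    rwa [← tensorIncl_tmul, TensorProduct.tmul_zero] at h0
  | tmul f g => exact h f g
  | add a b ha hb => rw [map_add]; exact hadd _ _ ha hb

theorem ext_tmul {E : Type*} [NormedAddCommGroup E] [NormedSpace ℂ E]
    {S T : L2 (X × Y) →L[ℂ] E} (h : ∀ f g, S (tmul f g) = T (tmul f g)) : S = T := by
  ext1 Θ
  refine tmul_induction (p := fun Θ => S Θ = T Θ) (isClosed_eq S.continuous T.continuous) ?_ h Θ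
  intro a b ha hb
  rw [map_add, map_add, ha, hb]

theorem ext_tmul_tmul {E : Type*} [NormedAddCommGroup E] [NormedSpace ℂ E]
    {S T : L2 (X × (Y × Z)) →L[ℂ] E}
    (h : ∀ f g k, S (tmul f (tmul g k)) = T (tmul f (tmul g k))) : S = T := by
  refine ext_tmul fun f Θ => ?_
  have : S ∘L tmulLeft f = T ∘L tmulLeft f := ext_tmul fun g k => h f g k
  exact congr($this Θ)

theorem ext_tmul_tmul_left {E : Type*} [NormedAddCommGroup E] [NormedSpace ℂ E]
    {S T : L2 ((X × Y) × Z) →L[ℂ] E}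
    (h : ∀ f g k, S (tmul (tmul f g) k) = T (tmul (tmul f g) k)) : S = T := by
  refine ext_tmul fun Θ k => ?_
  have : S ∘L tmulRight k = T ∘L tmulRight k := ext_tmul fun f g => h f g k
  exact congr($this Θ)

theorem ext_inner_tmul {Θ Θ' : L2 (X × Y)}
    (h : ∀ f g, ⟪tmul f g, Θ⟫_ℂ = ⟪tmul f g, Θ'⟫_ℂ) : Θ = Θ' := by
  have : innerSL ℂ Θ = innerSL ℂ Θ' := ext_tmul fun f g => by
    rw [innerSL_apply_apply, innerSL_apply_apply, ← inner_conj_symm, h, inner_conj_symm]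
  refine ext_inner_right ℂ fun v => ?_
  exact congr($this v)

theorem tmul_add_left (f f' : L2 X) (g : L2 Y) : tmul (f + f') g = tmul f g + tmul f' g :=
  map_add (tmulRight g) f f'

theorem tmul_add_right (f : L2 X) (g g' : L2 Y) : tmul f (g + g') = tmul f g + tmul f g' :=
  map_add (tmulLeft f) g g'

theorem tmul_smul_left (c : ℂ) (f : L2 X) (g : L2 Y) : tmul (c • f) g = c • tmul f g :=
  map_smul (tmulRight g) c f

theorem tmul_smul_right (c : ℂ) (f : L2 X) (g : L2 Y) : tmul f (c • g) = c • tmul f g :=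
  map_smul (tmulLeft f) c g

theorem opTensor_mul (S S' : Op X) (T T' : Op Y) :
    opTensor S T * opTensor S' T' = opTensor (S * S') (T * T') :=
  ext_tmul fun f g => by simp only [mul_def, comp_apply, opTensor_tmul]

theorem opTensor_one : opTensor (1 : Op X) (1 : Op Y) = 1 :=
  ext_tmul fun f g => by rw [opTensor_tmul]; rfl

theorem star_opTensor (S : Op X) (T : Op Y) :
    star (opTensor S T) = opTensor (star S) (star T) :=
  ext_tmul fun f g => ext_inner_tmul fun f' g' => by
    simp only [star_eq_adjoint, adjoint_inner_right, opTensor_tmul, inner_tmul_tmul]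

theorem norm_opTensor_le (S : Op X) (T : Op Y) : ‖opTensor S T‖ ≤ ‖S‖ * ‖T‖ := by
  refine opNorm_le_bound _ (by positivity) fun Θ => ?_
  refine denseRange_tensorIncl.induction_on (p := fun Θ => ‖opTensor S T Θ‖ ≤ ‖S‖ * ‖T‖ * ‖Θ‖)
    Θ (isClosed_le (by fun_prop) (by fun_prop)) fun t => ?_
  have h : opTensor S T (tensorIncl t) = tensorIncl (TensorProduct.mapL S T t) :=
    ContinuousLinearMap.extend_eq (e := tensorInclL (X := X) (Y := Y))
      (tensorInclL ∘L TensorProduct.mapL S T) denseRange_tensorIncl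
      (tensorIncl (X := X) (Y := Y)).isometry.isUniformInducing t
  rw [h, LinearIsometry.norm_map, LinearIsometry.norm_map]
  refine (le_opNorm _ _).trans ?_
  gcongr
  exact TensorProduct.norm_mapL_le S T

theorem opTensor_add_left (S S' : Op X) (T : Op Y) :
    opTensor (S + S') T = opTensor S T + opTensor S' T :=
  ext_tmul fun f g => by
    simp only [opTensor_tmul, add_apply, tmul_add_left]

theorem opTensor_add_right (S : Op X) (T T' : Op Y) :
    opTensor S (T + T') = opTensor S T + opTensor S T' :=
  ext_tmul fun f g => by
    simp only [opTensor_tmul, add_apply, tmul_add_right]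

theorem opTensor_smul_left (c : ℂ) (S : Op X) (T : Op Y) :
    opTensor (c • S) T = c • opTensor S T :=
  ext_tmul fun f g => by
    simp only [opTensor_tmul, smul_apply, tmul_smul_left]

theorem opTensor_smul_right (c : ℂ) (S : Op X) (T : Op Y) :
    opTensor S (c • T) = c • opTensor S T :=
  ext_tmul fun f g => by
    simp only [opTensor_tmul, smul_apply, tmul_smul_right]

/-- The bounded bilinear map `(S, T) ↦ S ⊗ T`. -/
def opTensorL : Op X →L[ℂ] Op Y →L[ℂ] Op (X × Y) :=
  (LinearMap.mk₂ ℂ opTensor opTensor_add_left opTensor_smul_left opTensor_add_right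
    opTensor_smul_right).mkContinuous₂ 1 fun S T => by
      rw [one_mul]; exact norm_opTensor_le S T

theorem adjoint_tmulLeft_tmul (f f' : L2 X) (g : L2 Y) :
    adjoint (tmulLeft f) (tmul f' g) = ⟪f, f'⟫_ℂ • g :=
  ext_inner_left ℂ fun k => by
    rw [adjoint_inner_right, tmulLeft_apply, inner_tmul_tmul, inner_smul_right]

theorem adjoint_tmulRight_tmul (f : L2 X) (g g' : L2 Y) :
    adjoint (tmulRight g) (tmul f g') = ⟪g, g'⟫_ℂ • f :=
  ext_inner_left ℂ fun k => by
    rw [adjoint_inner_right, tmulRight_apply, inner_tmul_tmul, inner_smul_right, mul_comm]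

theorem opTensor_comp_tmulLeft (S : Op X) (T : Op Y) (f : L2 X) :
    opTensor S T ∘L tmulLeft f = tmulLeft (S f) ∘L T := by
  ext1 g
  exact opTensor_tmul S T f g

theorem tmulLeft_add (f f' : L2 X) :
    (tmulLeft (f + f') : L2 Y →L[ℂ] L2 (X × Y)) = tmulLeft f + tmulLeft f' := by
  ext1 g
  simp only [add_apply, tmulLeft_apply, tmul_add_left]

theorem tmulLeft_smul (c : ℂ) (f : L2 X) :
    (tmulLeft (c • f) : L2 Y →L[ℂ] L2 (X × Y)) = c • tmulLeft f := by
  ext1 g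
  simp only [smul_apply, tmulLeft_apply, tmul_smul_left]

theorem continuous_tmulLeft : Continuous (tmulLeft : L2 X → L2 Y →L[ℂ] L2 (X × Y)) := by
  let F : L2 X →ₗ[ℂ] L2 Y →L[ℂ] L2 (X × Y) :=
    { toFun := tmulLeft, map_add' := tmulLeft_add, map_smul' := tmulLeft_smul }
  exact (F.mkContinuous 1 fun f => by rw [one_mul]; exact norm_tmulLeft_le f).continuous

end TensorOperators

/-! ### Vector slices and normal functionals. -/

section Slices

variable {X Y : Type*} [MeasureSpace X] [MeasureSpace Y]
  [SigmaFinite (volume : Measure X)] [SigmaFinite (volume : Measure Y)]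

/-- The slice `(ω ⊗ id)(T)` by the vector functional `ω = ⟨g, · f⟩`. -/
def vecSlice (T : Op (X × Y)) (g f : L2 X) : Op Y :=
  adjoint (tmulLeft g) ∘L T ∘L tmulLeft f

theorem star_vecSlice (T : Op (X × Y)) (g f : L2 X) :
    star (vecSlice T g f) = vecSlice (star T) f g := by
  simp only [vecSlice, star_eq_adjoint, adjoint_comp, adjoint_adjoint, comp_assoc]

theorem continuous_vecSlice (T : Op (X × Y)) :
    Continuous fun p : L2 X × L2 X => vecSlice T p.1 p.2 := by
  have h1 : Continuous fun p : L2 X × L2 X =>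
      adjoint (tmulLeft p.1 : L2 Y →L[ℂ] L2 (X × Y)) :=
    (LinearIsometryEquiv.continuous _).comp (continuous_tmulLeft.comp continuous_fst)
  exact h1.clm_comp (continuous_const.clm_comp (continuous_tmulLeft.comp continuous_snd))

theorem vecSlice_add_left (T : Op (X × Y)) (g g' f : L2 X) :
    vecSlice T (g + g') f = vecSlice T g f + vecSlice T g' f := by
  simp only [vecSlice, tmulLeft_add, map_add, add_comp]

theorem vecSlice_add_right (T : Op (X × Y)) (g f f' : L2 X) :
    vecSlice T g (f + f') = vecSlice T g f + vecSlice T g f' := by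
  simp only [vecSlice, tmulLeft_add, comp_add]

theorem vecSlice_smul_right (T : Op (X × Y)) (c : ℂ) (g f : L2 X) :
    vecSlice T g (c • f) = c • vecSlice T g f := by
  simp only [vecSlice, tmulLeft_smul, comp_smul]

/-- A factor on the sliced leg is absorbed by the functional, and a factor on the other leg comes
out of the slice. This is what removes $j$ and $Z_{12}$. -/
theorem vecSlice_mul_left (T : Op (X × Y)) (S : Op X) (R : Op Y) (g f : L2 X) :
    vecSlice (opTensor S R * T) g f = R * vecSlice T (star S g) f := by
  have h := opTensor_comp_tmulLeft (star S) (star R) g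
  rw [← star_opTensor] at h
  have h2 := congr(adjoint $h)
  simp only [adjoint_comp, star_eq_adjoint, adjoint_adjoint] at h2
  simp only [vecSlice, mul_def, ← comp_assoc, star_eq_adjoint]
  rw [h2]

theorem vecSlice_mul_right (T : Op (X × Y)) (S : Op X) (R : Op Y) (g f : L2 X) :
    vecSlice (T * opTensor S R) g f = vecSlice T g (S f) * R := by
  simp only [vecSlice, mul_def, comp_assoc, opTensor_comp_tmulLeft]

/-- The linear span of the slices of `T` by vector functionals. -/
def sliceSpan (T : Op (X × Y)) : Submodule ℂ (Op Y) :=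
  Submodule.span ℂ {R | ∃ g f, R = vecSlice T g f}

theorem vecSlice_mem (T : Op (X × Y)) (g f : L2 X) : vecSlice T g f ∈ sliceSpan T :=
  Submodule.subset_span ⟨g, f, rfl⟩

/-- Interleaving of two sequences. -/
def interleave {α : Type*} (a b : ℕ → α) (k : ℕ) : α := if Even k then a (k / 2) else b (k / 2)

theorem interleave_even {α : Type*} (a b : ℕ → α) (k : ℕ) : interleave a b (2 * k) = a k := by
  simp [interleave]

theorem interleave_odd {α : Type*} (a b : ℕ → α) (k : ℕ) : interleave a b (2 * k + 1) = b k := by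
  have : (2 * k + 1) / 2 = k := by omega
  simp [interleave, this]

theorem summable_interleave {α : Type*} (a b : ℕ → α) (N : α → ℝ)
    (ha : Summable fun k => N (a k)) (hb : Summable fun k => N (b k)) :
    Summable fun k => N (interleave a b k) :=
  (HasSum.even_add_odd (f := fun k => N (interleave a b k))
    (by simpa only [interleave_even] using ha.hasSum)
    (by simpa only [interleave_odd] using hb.hasSum)).summable

theorem hasSum_vecSlice (ω : NormalFunctional (L2 X)) (T : Op (X × Y)) :
    HasSum (fun k => vecSlice T (ω.η k) (ω.ξ k)) (leftSlice ω T) :=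
  hasSum_leftSlice ω T

theorem leftSlice_eq_of_hasSum {ω : NormalFunctional (L2 X)} {T : Op (X × Y)} {R : Op Y}
    (h : HasSum (fun k => vecSlice T (ω.η k) (ω.ξ k)) R) : leftSlice ω T = R :=
  (hasSum_leftSlice ω T).unique h

/-- The left slices of an operator form a linear subspace. -/
def leftSliceSubmodule (T : Op (X × Y)) : Submodule ℂ (Op Y) where
  carrier := Set.range fun ω : NormalFunctional (L2 X) => leftSlice ω T
  zero_mem' := ⟨⟨0, 0, by simp, by simp⟩,
    leftSlice_eq_of_hasSum (by
      convert hasSum_zero using 2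
      simpa using vecSlice_smul_right T 0 0 0)⟩
  add_mem' := by
    rintro _ _ ⟨ω, rfl⟩ ⟨ω', rfl⟩
    -- The sum of two series of vector functionals is a single series once the sequences are
    -- interleaved.
    refine ⟨⟨interleave ω.ξ ω'.ξ, interleave ω.η ω'.η,
      summable_interleave _ _ (fun v => ‖v‖ ^ 2) ω.summable_ξ ω'.summable_ξ,
      summable_interleave _ _ (fun v => ‖v‖ ^ 2) ω.summable_η ω'.summable_η⟩,
      leftSlice_eq_of_hasSum (HasSum.even_add_odd ?_ ?_)⟩
    · simpa only [interleave_even] using hasSum_vecSlice ω T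
    · simpa only [interleave_odd] using hasSum_vecSlice ω' T
  smul_mem' := by
    rintro c _ ⟨ω, rfl⟩
    -- The scalar goes on $\xi$, since the value is conjugate-linear in $\eta$.
    refine ⟨⟨fun k => c • ω.ξ k, ω.η, ?_, ω.summable_η⟩, leftSlice_eq_of_hasSum ?_⟩
    · simpa only [norm_smul, mul_pow] using ω.summable_ξ.mul_left (‖c‖ ^ 2)
    · simpa only [vecSlice_smul_right] using (hasSum_vecSlice ω T).const_smul c

/-- A normal slice is a norm limit of finite sums of vector slices; conversely a vector functional
is a normal functional with one nonzero term, and normal slices already form a subspace. From here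
on only vector functionals are needed. -/
theorem leftSliceClosure_eq (T : Op (X × Y)) :
    leftSliceClosure T = ((sliceSpan T).topologicalClosure : Set (Op Y)) := by
  refine subset_antisymm (closure_minimal ?_ isClosed_closure) (closure_mono ?_)
  · rintro _ ⟨ω, rfl⟩
    refine mem_closure_of_tendsto (hasSum_vecSlice ω T) (Filter.Eventually.of_forall fun s => ?_)
    exact Submodule.sum_mem _ fun k _ => vecSlice_mem T _ _
  · change ((sliceSpan T : Set (Op Y))) ⊆ (leftSliceSubmodule T : Set (Op Y))
    refine Submodule.span_le.2 ?_
    rintro _ ⟨g, f, rfl⟩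
    have hs : ∀ v : L2 X, Summable fun k : ℕ => ‖(Pi.single 0 v : ℕ → L2 X) k‖ ^ 2 := fun v =>
      summable_of_ne_finset_zero (s := {0}) fun k hk => by
        rw [Pi.single_eq_of_ne (by simpa using hk)]; simp
    refine ⟨⟨Pi.single 0 f, Pi.single 0 g, hs f, hs g⟩, leftSlice_eq_of_hasSum ?_⟩
    convert hasSum_single (f := fun k : ℕ => vecSlice T ((Pi.single 0 g : ℕ → L2 X) k)
      ((Pi.single 0 f : ℕ → L2 X) k)) 0 fun k hk => ?_ using 1
    · simp
    · rw [Pi.single_eq_of_ne hk, Pi.single_eq_of_ne hk]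
      simpa using vecSlice_smul_right T 0 0 0

end Slices

/-! ### Triple tensor products and leg numbering. -/

section Composition

variable {X Y : Type*} [MeasureSpace X] [MeasureSpace Y]

/-- The isometry `ξ ↦ ξ ∘ φ` for a measure preserving map `φ`. -/
def compOp (φ : Y → X) (h : MeasurePreserving φ) : L2 X →L[ℂ] L2 Y :=
  (Lp.compMeasurePreservingₗᵢ ℂ φ h).toContinuousLinearMap

theorem coeFn_compOp (φ : Y → X) (h : MeasurePreserving φ) (ξ : L2 X) :
    compOp φ h ξ =ᵐ[volume] fun y => ξ (φ y) :=
  Lp.coeFn_compMeasurePreserving ξ h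

end Composition

section Associator

variable {X Y Z : Type*} [MeasureSpace X] [MeasureSpace Y] [MeasureSpace Z]
  [SigmaFinite (volume : Measure X)] [SigmaFinite (volume : Measure Y)]
  [SigmaFinite (volume : Measure Z)]

/-- The identification of `L²((X × Y) × Z)` with `L²(X × (Y × Z))`. -/
def assocOp : L2 ((X × Y) × Z) →L[ℂ] L2 (X × (Y × Z)) :=
  compOp MeasurableEquiv.prodAssoc.symm
    (measurePreserving_prodAssoc (volume : Measure X) (volume : Measure Y)
      (volume : Measure Z)).symm

/-- The inverse of `assocOp`. -/
def assocInv : L2 (X × (Y × Z)) →L[ℂ] L2 ((X × Y) × Z) :=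
  compOp MeasurableEquiv.prodAssoc
    (measurePreserving_prodAssoc (volume : Measure X) (volume : Measure Y) (volume : Measure Z))

theorem assocOp_tmul (f : L2 X) (g : L2 Y) (k : L2 Z) :
    assocOp (tmul (tmul f g) k) = tmul f (tmul g k) := by
  apply Lp.ext
  have hm := (measurePreserving_prodAssoc (volume : Measure X) (volume : Measure Y)
      (volume : Measure Z)).symm
  filter_upwards [coeFn_compOp _ hm (tmul (tmul f g) k),
    hm.quasiMeasurePreserving.ae (coeFn_tmul (tmul f g) k),
    hm.quasiMeasurePreserving.ae (ae_fst (Y := Z) (coeFn_tmul f g)),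
    coeFn_tmul f (tmul g k), ae_snd (X := X) (coeFn_tmul g k)] with p h1 h2 h3 h4 h5
  refine h1.trans ?_
  rw [h2, h3, h4, h5]
  simp [MeasurableEquiv.prodAssoc, mul_assoc]

theorem assocInv_tmul (f : L2 X) (g : L2 Y) (k : L2 Z) :
    assocInv (tmul f (tmul g k)) = tmul (tmul f g) k := by
  apply Lp.ext
  have hm := measurePreserving_prodAssoc (volume : Measure X) (volume : Measure Y)
      (volume : Measure Z)
  filter_upwards [coeFn_compOp _ hm (tmul f (tmul g k)),
    hm.quasiMeasurePreserving.ae (coeFn_tmul f (tmul g k)),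
    hm.quasiMeasurePreserving.ae (ae_snd (X := X) (coeFn_tmul g k)),
    coeFn_tmul (tmul f g) k, ae_fst (Y := Z) (coeFn_tmul f g)] with p h1 h2 h3 h4 h5
  refine h1.trans ?_
  rw [h2, h3, h4, h5]
  simp [MeasurableEquiv.prodAssoc, mul_assoc]

theorem assocOp_comp_assocInv : assocOp ∘L assocInv = (1 : Op (X × (Y × Z))) :=
  ext_tmul_tmul fun f g k => by
    rw [comp_apply, assocInv_tmul, assocOp_tmul]; rfl

theorem assocInv_comp_assocOp : assocInv ∘L assocOp = (1 : Op ((X × Y) × Z)) :=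
  ext_tmul_tmul_left fun f g k => by
    rw [comp_apply, assocOp_tmul, assocInv_tmul]; rfl

theorem norm_assocOp_apply (Θ : L2 ((X × Y) × Z)) : ‖assocOp Θ‖ = ‖Θ‖ :=
  LinearIsometry.norm_map _ Θ

theorem adjoint_assocOp : adjoint (assocOp (X := X) (Y := Y) (Z := Z)) = assocInv := by
  have h : adjoint assocOp ∘L assocOp = (1 : Op ((X × Y) × Z)) :=
    (norm_map_iff_adjoint_comp_self _).1 norm_assocOp_apply
  calc adjoint (assocOp (X := X) (Y := Y) (Z := Z))
      = (adjoint assocOp ∘L assocOp) ∘L assocInv := by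
        rw [comp_assoc, assocOp_comp_assocInv]; rfl
    _ = assocInv := by rw [h]; rfl

/-- The operator `T ⊗ 1` on `L²(X × (Y × Z))`, for `T` acting on the first two legs. -/
def tri12 (T : Op (X × Y)) : Op (X × (Y × Z)) := assocOp ∘L opTensor T 1 ∘L assocInv

theorem tri12_comp_assocOp (T : Op (X × Y)) :
    tri12 T ∘L assocOp (X := X) (Y := Y) (Z := Z) = assocOp ∘L opTensor T 1 := by
  rw [tri12, comp_assoc, comp_assoc, assocInv_comp_assocOp]; rfl

theorem tri12_tmul (T : Op (X × Y)) (f : L2 X) (g : L2 Y) (k : L2 Z) :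
    tri12 T (tmul f (tmul g k)) = assocOp (tmul (T (tmul f g)) k) := by
  rw [← assocOp_tmul, ← comp_apply, tri12_comp_assocOp, comp_apply, opTensor_tmul]; rfl

theorem tri12_mul (S T : Op (X × Y)) :
    (tri12 S * tri12 T : Op (X × (Y × Z))) = tri12 (S * T) := by
  change tri12 S ∘L assocOp ∘L opTensor T 1 ∘L assocInv = _
  rw [← comp_assoc, tri12_comp_assocOp, comp_assoc, ← comp_assoc (opTensor S 1), ← mul_def,
    opTensor_mul, one_mul]; rfl

theorem tri12_one : (tri12 (1 : Op (X × Y)) : Op (X × (Y × Z))) = 1 := by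
  rw [tri12, opTensor_one, ← assocOp_comp_assocInv]; rfl

theorem star_tri12 (T : Op (X × Y)) : star (tri12 T : Op (X × (Y × Z))) = tri12 (star T) := by
  have h : adjoint (assocInv (X := X) (Y := Y) (Z := Z)) = assocOp := by
    rw [← adjoint_assocOp, adjoint_adjoint]
  rw [star_eq_adjoint, tri12, adjoint_comp, adjoint_comp, h, adjoint_assocOp,
    ← star_eq_adjoint, star_opTensor, star_one, comp_assoc]; rfl

theorem adjoint_tmulLeft_assocOp_tmul (g : L2 X) (Θ : L2 (X × Y)) (k : L2 Z) :
    adjoint (tmulLeft g) (assocOp (tmul Θ k)) = tmul (adjoint (tmulLeft g) Θ) k := by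
  have : adjoint (tmulLeft g) ∘L assocOp ∘L tmulRight (X := X × Y) k =
      tmulRight k ∘L adjoint (tmulLeft g) := ext_tmul fun a b => by
    simp only [comp_apply, tmulRight_apply, assocOp_tmul, adjoint_tmulLeft_tmul, tmul_smul_left]
  exact congr($this Θ)

theorem vecSlice_tri12 (T : Op (X × Y)) (g f : L2 X) :
    vecSlice (tri12 T : Op (X × (Y × Z))) g f = opTensor (vecSlice T g f) 1 :=
  ext_tmul fun a b => by
    rw [vecSlice, comp_apply, comp_apply, tmulLeft_apply, tri12_tmul,
      adjoint_tmulLeft_assocOp_tmul, opTensor_tmul]; rfl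

/-- The bounded operator `k ↦ Ψ ⊗ k` from `L²(Z)` to `L²(X × (Y × Z))`. -/
def insertPair (Ψ : L2 (X × Y)) : L2 Z →L[ℂ] L2 (X × (Y × Z)) := assocOp ∘L tmulLeft Ψ

theorem insertPair_tmul (f : L2 X) (g : L2 Y) :
    (insertPair (tmul f g) : L2 Z →L[ℂ] _) = tmulLeft f ∘L tmulLeft g := by
  ext1 k
  exact assocOp_tmul f g k

/-- An operator on the first two legs acts only on the inserted vector; the factors $V_{12}$ of the
pentagon equation disappear this way. -/
theorem tri12_comp_insertPair (T : Op (X × Y)) (Ψ : L2 (X × Y)) :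
    tri12 T ∘L (insertPair Ψ : L2 Z →L[ℂ] _) = insertPair (T Ψ) := by
  rw [insertPair, ← comp_assoc, tri12_comp_assocOp, comp_assoc, opTensor_comp_tmulLeft]; rfl

theorem insertPair_add (Ψ Φ : L2 (X × Y)) :
    (insertPair (Ψ + Φ) : L2 Z →L[ℂ] _) = insertPair Ψ + insertPair Φ := by
  simp only [insertPair, tmulLeft_add, comp_add]

theorem continuous_insertPair :
    Continuous (insertPair : L2 (X × Y) → L2 Z →L[ℂ] L2 (X × (Y × Z))) :=
  continuous_const.clm_comp continuous_tmulLeft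

end Associator

/-! ### C*-algebras from the pentagon equation. -/

theorem isConcreteCStarAlgebra_span {X : Type*} [MeasureSpace X] {s : Set (Op X)}
    (hmul : ∀ a b, a ∈ s → b ∈ s → a * b ∈ (Submodule.span ℂ s).topologicalClosure)
    (hstar : ∀ a ∈ s, star a ∈ (Submodule.span ℂ s).topologicalClosure) :
    IsConcreteCStarAlgebra ((Submodule.span ℂ s).topologicalClosure : Set (Op X)) := by
  set M := (Submodule.span ℂ s).topologicalClosure with hM
  have hcl : IsClosed (M : Set (Op X)) := Submodule.isClosed_topologicalClosure _
  -- Closed linear conditions pass from the generators to the closed span. For products this is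
  -- applied in each factor separately.
  have induct : ∀ {p : Op X → Prop}, IsClosed {a | p a} → (∀ a ∈ s, p a) → p 0 →
      (∀ a b, p a → p b → p (a + b)) → (∀ (c : ℂ) a, p a → p (c • a)) → ∀ a ∈ M, p a := by
    intro p hp hs h0 hadd hsmul a ha
    refine closure_minimal (s := (Submodule.span ℂ s : Set (Op X))) (t := {a | p a})
      (fun b hb => ?_) hp ha
    induction hb using Submodule.span_induction with
    | mem x hx => exact hs x hx
    | zero => exact h0
    | add x y _ _ hx hy => exact hadd x y hx hy
    | smul c x _ hx => exact hsmul c x hx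
  refine ⟨hcl, ⟨{ M with
    mul_mem' := fun {a b} ha hb => ?_
    star_mem' := fun {a} ha => ?_ }, rfl⟩⟩
  · refine induct (p := fun a => a * b ∈ M) (hcl.preimage (by fun_prop)) (fun a ha => ?_)
      (by simp) (fun x y hx hy => by rw [add_mul]; exact add_mem hx hy)
      (fun c x hx => by rw [smul_mul_assoc]; exact M.smul_mem c hx) a ha
    exact induct (p := fun b => a * b ∈ M) (hcl.preimage (by fun_prop)) (fun b hb => hmul a b ha hb)
      (by simp) (fun x y hx hy => by rw [mul_add]; exact add_mem hx hy)
      (fun c x hx => by rw [mul_smul_comm]; exact M.smul_mem c hx) b hb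
  · exact induct (p := fun a => star a ∈ M) (hcl.preimage continuous_star) hstar
      (by simp) (fun x y hx hy => by rw [star_add]; exact add_mem hx hy)
      (fun c x hx => by rw [star_smul]; exact M.smul_mem _ hx) a ha

section Products

variable {X : Type*} [MeasureSpace X] [SigmaFinite (volume : Measure X)]

theorem coeFn_flipOp (Θ : L2 (X × X)) : flipOp Θ =ᵐ[volume] fun p => Θ p.swap :=
  Lp.coeFn_compMeasurePreserving Θ Measure.measurePreserving_swap

theorem flipOp_tmul (f g : L2 X) : flipOp (tmul f g) = tmul g f := by
  apply Lp.ext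
  filter_upwards [coeFn_flipOp (tmul f g), coeFn_tmul g f,
    Measure.measurePreserving_swap.quasiMeasurePreserving.ae (coeFn_tmul f g)] with p h1 h2 h3
  rw [h1, h2, h3, Prod.fst_swap, Prod.snd_swap, mul_comm]

theorem flipOp_mul_flipOp : flipOp * flipOp = (1 : Op (X × X)) :=
  ext_tmul fun f g => by rw [mul_def, comp_apply, flipOp_tmul, flipOp_tmul]; rfl

theorem star_flipOp : star flipOp = (flipOp : Op (X × X)) :=
  ext_tmul fun f g => ext_inner_tmul fun f' g' => by
    rw [star_eq_adjoint, adjoint_inner_right, flipOp_tmul, flipOp_tmul, inner_tmul_tmul,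
      inner_tmul_tmul, mul_comm]

theorem flipOp_mul_opTensor_mul_flipOp (S T : Op X) :
    flipOp * opTensor S T * flipOp = opTensor T S :=
  ext_tmul fun f g => by
    simp only [mul_def, comp_apply, flipOp_tmul, opTensor_tmul]

/-- The operator on `L²(X × (X × X))` given by `T` acting on the first and the third leg. -/
def tri13 (T : Op (X × X)) : Op (X × (X × X)) :=
  opTensor 1 flipOp * tri12 T * opTensor 1 flipOp

theorem vecSlice_tri13 (T : Op (X × X)) (g f : L2 X) :
    vecSlice (tri13 T) g f = opTensor 1 (vecSlice T g f) := by
  rw [tri13, vecSlice_mul_right, vecSlice_mul_left, star_one]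
  change flipOp * vecSlice (tri12 T) g f * flipOp = _
  rw [vecSlice_tri12, flipOp_mul_opTensor_mul_flipOp]

theorem star_tri13 (T : Op (X × X)) : star (tri13 T) = tri13 (star T) := by
  simp only [tri13, star_mul, star_opTensor, star_one, star_flipOp, star_tri12, mul_assoc]

/-- The slice of `T`, acting on the last two legs, by the vector functional `⟨Ψ, · Φ⟩` on the
first two legs. -/
def pairSlice (T : Op (X × X)) (Ψ Φ : L2 (X × X)) : Op X :=
  adjoint (insertPair Ψ) ∘L opTensor 1 T ∘L insertPair Φ

/-- Both vectors may be taken elementary by density. The operator does not touch the first leg,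
which then contributes only the scalar $\langle g,f\rangle$. -/
theorem pairSlice_mem (T : Op (X × X)) (Ψ Φ : L2 (X × X)) :
    pairSlice T Ψ Φ ∈ (sliceSpan T).topologicalClosure := by
  have hcl := (sliceSpan T).isClosed_topologicalClosure
  refine tmul_induction (p := fun Ψ => pairSlice T Ψ Φ ∈ (sliceSpan T).topologicalClosure)
    (hcl.preimage ?_) (fun a b ha hb => ?_) (fun g g' => ?_) Ψ
  · exact ((LinearIsometryEquiv.continuous _).comp continuous_insertPair).clm_comp
      continuous_const
  · have : pairSlice T (a + b) Φ = pairSlice T a Φ + pairSlice T b Φ := by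
      simp only [pairSlice, insertPair_add, map_add, add_comp]
    rw [this]
    exact add_mem ha hb
  refine tmul_induction
    (p := fun Φ => pairSlice T (tmul g g') Φ ∈ (sliceSpan T).topologicalClosure)
    (hcl.preimage ?_) (fun a b ha hb => ?_) (fun f f' => ?_) Φ
  · exact continuous_const.clm_comp (continuous_const.clm_comp continuous_insertPair)
  · have : pairSlice T (tmul g g') (a + b) =
        pairSlice T (tmul g g') a + pairSlice T (tmul g g') b := by
      simp only [pairSlice, insertPair_add, comp_add]
    rw [this]
    exact add_mem ha hb
  · have : pairSlice T (tmul g g') (tmul f f') = ⟪g, f⟫_ℂ • vecSlice T g' f' := by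
      ext1 k
      simp only [pairSlice, insertPair_tmul, vecSlice, comp_apply, adjoint_comp, smul_apply,
        tmulLeft_apply, opTensor_tmul, adjoint_tmulLeft_tmul, map_smul]
      rfl
    rw [this]
    exact Submodule.smul_mem _ _ (Submodule.le_topologicalClosure _ (vecSlice_mem T g' f'))

theorem adjoint_tmulLeft_comp_opTensor (g : L2 X) (S : Op X) :
    adjoint (tmulLeft g) ∘L opTensor 1 S = S ∘L adjoint (tmulLeft g) :=
  ext_tmul fun a b => by
    rw [comp_apply, comp_apply, opTensor_tmul, adjoint_tmulLeft_tmul, adjoint_tmulLeft_tmul,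
      map_smul]
    rfl

/-- The product is the slice of $V_{13}V_{23}$ at $(g\otimes g',f\otimes f')$. By the pentagon this
operator is $V_{12}^*V_{23}V_{12}$, and the two outer factors act on the vectors. -/
theorem vecSlice_mul_vecSlice {V : Op (X × X)} (hV : star V * V = 1)
    (pentagon : tri12 V * tri13 V * opTensor 1 V = opTensor 1 V * tri12 V) (g f g' f' : L2 X) :
    vecSlice V g f * vecSlice V g' f' = pairSlice V (V (tmul g g')) (V (tmul f f')) := by
  -- Cancelling $V_{12}$ on the left needs only that $V$ is an isometry.
  have h13 : tri13 V * opTensor 1 V = star (tri12 V) * (opTensor 1 V * tri12 V) := by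
    rw [← pentagon, mul_assoc (tri12 V), ← mul_assoc (star _), star_tri12, tri12_mul, hV,
      tri12_one, one_mul]
  have h23 : opTensor 1 V ∘L tmulLeft f = tmulLeft f ∘L V := opTensor_comp_tmulLeft 1 V f
  calc vecSlice V g f * vecSlice V g' f'
      = (vecSlice V g f ∘L adjoint (tmulLeft g')) ∘L V ∘L tmulLeft f' := rfl
    -- The first slice is moved past $\langle g'|$ as $1\otimes(\text{slice})$, which is the slice
    -- of $V_{13}$.
    _ = adjoint (tmulLeft g') ∘L vecSlice (tri13 V) g f ∘L V ∘L tmulLeft f' := by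
      rw [← adjoint_tmulLeft_comp_opTensor, ← vecSlice_tri13, comp_assoc]
    _ = adjoint (tmulLeft g') ∘L adjoint (tmulLeft g) ∘L tri13 V ∘L
          (tmulLeft f ∘L V) ∘L tmulLeft f' := rfl
    _ = (adjoint (tmulLeft g') ∘L adjoint (tmulLeft g)) ∘L (tri13 V * opTensor 1 V) ∘L
          tmulLeft f ∘L tmulLeft f' := by rw [← h23]; rfl
    _ = adjoint (insertPair (tmul g g')) ∘L (star (tri12 V) * (opTensor 1 V * tri12 V)) ∘L
          insertPair (tmul f f') := by rw [h13, insertPair_tmul, insertPair_tmul, adjoint_comp]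
    _ = (adjoint (insertPair (tmul g g')) ∘L adjoint (tri12 V)) ∘L opTensor 1 V ∘L
          tri12 V ∘L insertPair (tmul f f') := rfl
    _ = _ := by rw [← adjoint_comp, tri12_comp_insertPair, tri12_comp_insertPair]; rfl

/-- The slices of a multiplicative isometry form a C*-algebra as soon as the slices by vector
functionals are stable under the involution. -/
theorem isConcreteCStarAlgebra_of_pentagon {V : Op (X × X)} (hV : star V * V = 1)
    (pentagon : tri12 V * tri13 V * opTensor 1 V = opTensor 1 V * tri12 V)
    (hstar : ∀ g f, ∃ g' f', star (vecSlice V g f) = vecSlice V g' f') :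
    IsConcreteCStarAlgebra (leftSliceClosure V) := by
  rw [leftSliceClosure_eq]
  refine isConcreteCStarAlgebra_span ?_ ?_
  · rintro _ _ ⟨g, f, rfl⟩ ⟨g', f', rfl⟩
    rw [vecSlice_mul_vecSlice hV pentagon]
    exact pairSlice_mem V _ _
  · rintro _ ⟨g, f, rfl⟩
    obtain ⟨g', f', h⟩ := hstar g f
    rw [h]
    exact Submodule.le_topologicalClosure _ (vecSlice_mem V g' f')

end Products

/-! ### Complex conjugation and Hilbert–Schmidt operators. -/

section Conjugation

variable {X : Type*} [MeasureSpace X]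

theorem star_add_L2 (f g : L2 X) : star (f + g) = star f + star g := by
  apply Lp.ext
  filter_upwards [Lp.coeFn_star (f + g), Lp.coeFn_add f g, Lp.coeFn_add (star f) (star g),
    Lp.coeFn_star f, Lp.coeFn_star g] with x h1 h2 h3 h4 h5
  rw [h1, h3, Pi.star_apply, h2, Pi.add_apply, Pi.add_apply, h4, h5, star_add]; rfl

theorem star_smul_L2 (c : ℂ) (f : L2 X) : star (c • f) = star c • star f := by
  apply Lp.ext
  filter_upwards [Lp.coeFn_star (c • f), Lp.coeFn_smul c f, Lp.coeFn_smul (star c) (star f),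
    Lp.coeFn_star f] with x h1 h2 h3 h4
  rw [h1, h3, Pi.star_apply, h2, Pi.smul_apply, Pi.smul_apply, h4, star_smul]; rfl

theorem norm_star_L2 (f : L2 X) : ‖star f‖ = ‖f‖ := by
  refine congrArg ENNReal.toReal (eLpNorm_congr_norm_ae ?_)
  filter_upwards [Lp.coeFn_star f] with x h
  rw [h, Pi.star_apply, norm_star]

/-- Both sides are the bilinear pairing $\int fg$, which is symmetric. -/
theorem inner_star_left (f g : L2 X) : ⟪star f, g⟫_ℂ = ⟪star g, f⟫_ℂ := by
  rw [L2.inner_def, L2.inner_def]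
  refine integral_congr_ae ?_
  filter_upwards [Lp.coeFn_star f, Lp.coeFn_star g] with x h1 h2
  rw [h1, h2]
  simp [mul_comm]

end Conjugation

section HilbertSchmidt

variable {X : Type*} [MeasureSpace X] [SigmaFinite (volume : Measure X)]

/-- The Hilbert–Schmidt operator with kernel `k`. -/
def hsOp : L2 (X × X) →L[ℂ] Op X :=
  -- Slicing against a vector is conjugate-linear in it; conjugating $c$ first restores linearity.
  (LinearMap.mk₂ ℂ (fun (k : L2 (X × X)) (c : L2 X) => adjoint (tmulRight (star c)) k)
    (fun k k' c => map_add _ k k') (fun a k c => map_smul _ a k)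
    (fun k c c' => ext_inner_left ℂ fun b => by
      simp only [inner_add_right, adjoint_inner_right, tmulRight_apply, star_add_L2,
        tmul_add_right, inner_add_left])
    (fun a k c => ext_inner_left ℂ fun b => by
      simp only [inner_smul_right, adjoint_inner_right, tmulRight_apply, star_smul_L2,
        tmul_smul_right, inner_smul_left]
      simp)).mkContinuous₂ 1 fun k c => by
        have h : ‖adjoint (tmulRight (star c) : L2 X →L[ℂ] L2 (X × X))‖ ≤ ‖c‖ := by
          rw [LinearIsometryEquiv.norm_map, ← norm_star_L2 c]
          exact norm_tmulRight_le _
        rw [one_mul, mul_comm]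
        exact ((adjoint (tmulRight (star c) : L2 X →L[ℂ] L2 (X × X))).le_opNorm k).trans (by gcongr)

theorem hsOp_apply (k : L2 (X × X)) (c : L2 X) : hsOp k c = adjoint (tmulRight (star c)) k := rfl

theorem inner_hsOp (a c : L2 X) (k : L2 (X × X)) :
    ⟪a, hsOp k c⟫_ℂ = ⟪tmul a (star c), k⟫_ℂ := by
  rw [hsOp_apply, adjoint_inner_right, tmulRight_apply]

theorem hsOp_tmul_apply (u v c : L2 X) : hsOp (tmul u v) c = ⟪star v, c⟫_ℂ • u := by
  rw [hsOp_apply, adjoint_tmulRight_tmul, inner_star_left]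

end HilbertSchmidt

/-! ### Four legs and the crossed slice. -/

section Insertion

variable {X : Type*} [MeasureSpace X] [SigmaFinite (volume : Measure X)]

theorem coeFn_midFlipOp (Θ : L2 ((X × X) × (X × X))) :
    midFlipOp Θ =ᵐ[volume] fun p => Θ (midSwap p) :=
  Lp.coeFn_compMeasurePreserving Θ measurePreserving_midSwap

theorem midFlipOp_tmul (a b c d : L2 X) :
    midFlipOp (tmul (tmul a b) (tmul c d)) = tmul (tmul a c) (tmul b d) := by
  apply Lp.ext
  have hm := (measurePreserving_midSwap (X := X)).quasiMeasurePreserving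
  filter_upwards [coeFn_midFlipOp (tmul (tmul a b) (tmul c d)),
    hm.ae (coeFn_tmul (tmul a b) (tmul c d)), hm.ae (ae_fst (Y := X × X) (coeFn_tmul a b)),
    hm.ae (ae_snd (X := X × X) (coeFn_tmul c d)), coeFn_tmul (tmul a c) (tmul b d),
    ae_fst (Y := X × X) (coeFn_tmul a c), ae_snd (X := X × X) (coeFn_tmul b d)]
    with p h1 h2 h3 h4 h5 h6 h7
  rw [h1, h2, h3, h4, h5, h6, h7]
  simp only [midSwap]
  ring

theorem ext_tmul_tmul_tmul {E : Type*} [NormedAddCommGroup E] [NormedSpace ℂ E]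
    {S T : L2 ((X × X) × (X × X)) →L[ℂ] E}
    (h : ∀ a b c d, S (tmul (tmul a b) (tmul c d)) = T (tmul (tmul a b) (tmul c d))) : S = T := by
  refine ext_tmul_tmul fun Θ c d => ?_
  have : S ∘L tmulRight (tmul c d) = T ∘L tmulRight (tmul c d) :=
    ext_tmul fun a b => h a b c d
  exact congr($this Θ)

theorem star_midFlipOp : star midFlipOp = (midFlipOp : Op ((X × X) × (X × X))) := by
  have h1 : (midFlipOp : Op ((X × X) × (X × X))) * midFlipOp = 1 :=
    ext_tmul_tmul_tmul fun a b c d => by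
      rw [mul_def, comp_apply, midFlipOp_tmul, midFlipOp_tmul]; rfl
  have h2 : star midFlipOp * midFlipOp = (1 : Op ((X × X) × (X × X))) :=
    (norm_map_iff_adjoint_comp_self _).1 fun Θ => LinearIsometry.norm_map _ Θ
  exact left_inv_eq_right_inv h2 h1

theorem star_leg24 (T : Op (X × X)) : star (leg24 T) = leg24 (star T) := by
  simp only [leg24, star_mul, star_opTensor, star_one, star_midFlipOp, mul_assoc]

/-- The operator `h ⊗ Θ ↦ (f ⊗ h) ⊗ Θ`. -/
def insertFst (f : L2 X) : L2 (X × (X × X)) →L[ℂ] L2 ((X × X) × (X × X)) :=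
  assocInv ∘L tmulLeft f

/-- The operator `h ⊗ Θ ↦ (h ⊗ f) ⊗ Θ`. -/
def insertSnd (f : L2 X) : L2 (X × (X × X)) →L[ℂ] L2 ((X × X) × (X × X)) :=
  opTensor flipOp 1 ∘L insertFst f

theorem insertFst_tmul (f h : L2 X) (Θ : L2 (X × X)) :
    insertFst f (tmul h Θ) = tmul (tmul f h) Θ :=
  assocInv_tmul f h Θ

theorem insertSnd_tmul (f h : L2 X) (Θ : L2 (X × X)) :
    insertSnd f (tmul h Θ) = tmul (tmul h f) Θ := by
  rw [insertSnd, comp_apply, insertFst_tmul, opTensor_tmul, flipOp_tmul]; rfl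

theorem midFlipOp_tmul_right (Θ : L2 (X × X)) (f d : L2 X) :
    midFlipOp (tmul Θ (tmul f d)) = insertSnd f (assocOp (tmul Θ d)) := by
  have : midFlipOp ∘L tmulRight (tmul f d) = insertSnd f ∘L assocOp ∘L tmulRight d :=
    ext_tmul fun a b => by
      simp only [comp_apply, tmulRight_apply, midFlipOp_tmul, assocOp_tmul, insertSnd_tmul]
  exact congr($this Θ)

theorem midFlipOp_tmul_left (f c : L2 X) (Θ : L2 (X × X)) :
    midFlipOp (tmul (tmul f c) Θ) = insertFst f (opTensor 1 flipOp (assocOp (tmul Θ c))) := by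
  have : midFlipOp ∘L tmulLeft (tmul f c) =
      insertFst f ∘L opTensor 1 flipOp ∘L assocOp ∘L tmulRight c :=
    ext_tmul fun a b => by
      simp only [comp_apply, tmulRight_apply, tmulLeft_apply, midFlipOp_tmul, assocOp_tmul,
        opTensor_tmul, flipOp_tmul]
      exact (insertFst_tmul _ _ _).symm
  exact congr($this Θ)

/-- With $f$ parked in the second leg, the remaining legs 1, 3, 4 see $T_{13}$ as an operator on
their first two. -/
theorem leg13_comp_insertSnd (T : Op (X × X)) (f : L2 X) :
    leg13 T ∘L insertSnd f = insertSnd f ∘L tri12 T :=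
  ext_tmul_tmul fun u c d => by
    simp only [leg13, mul_def, comp_apply, insertSnd_tmul, midFlipOp_tmul, opTensor_tmul,
      tri12_tmul, ← midFlipOp_tmul_right]
    rfl

/-- With $f$ parked in the first leg, the remaining legs 2, 3, 4 see $T_{24}$ as an operator on
their first and third. -/
theorem leg24_comp_insertFst (T : Op (X × X)) (f : L2 X) :
    leg24 T ∘L insertFst f = insertFst f ∘L tri13 T :=
  ext_tmul_tmul fun u c d => by
    simp only [leg24, tri13, mul_def, comp_apply, insertFst_tmul, midFlipOp_tmul, opTensor_tmul,
      flipOp_tmul]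
    change midFlipOp (tmul (tmul f c) _) = insertFst f (opTensor 1 flipOp (tri12 T (tmul u _)))
    rw [tri12_tmul, midFlipOp_tmul_left]

theorem tmulLeft_tmul_eq_insertFst (f g : L2 X) :
    (tmulLeft (tmul f g) : L2 (X × X) →L[ℂ] _) = insertFst f ∘L tmulLeft g := by
  ext1 Θ
  exact (insertFst_tmul f g Θ).symm

theorem tmulLeft_tmul_eq_insertSnd (f g : L2 X) :
    (tmulLeft (tmul f g) : L2 (X × X) →L[ℂ] _) = insertSnd g ∘L tmulLeft f := by
  ext1 Θ
  exact (insertSnd_tmul g f Θ).symm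

/-- The input of the second leg and the output of the first are fixed, so what is left of $T_{12}$
carries the first leg to the second. -/
theorem adjoint_insertFst_comp (T : Op (X × X)) (g f : L2 X) :
    adjoint (insertFst g) ∘L opTensor T 1 ∘L insertSnd f =
      opTensor (adjoint (tmulLeft g) ∘L T ∘L tmulRight f) 1 :=
  ext_tmul fun u Θ => by
    rw [comp_apply, comp_apply, insertSnd_tmul, opTensor_tmul, opTensor_tmul, insertFst,
      adjoint_comp, ← adjoint_assocOp, adjoint_adjoint, comp_apply,
      adjoint_tmulLeft_assocOp_tmul]
    rfl

/-- The slice of `Y₁₃ R₁ X₁₂` by the vector functional `⟨g, · f⟩` on the first leg. -/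
def bridge (S T : Op (X × X)) (g f : L2 X) (R : Op X) : Op (X × X) :=
  vecSlice (tri13 T * opTensor R 1 * tri12 S) g f

theorem bridge_add (S T : Op (X × X)) (g f : L2 X) (R R' : Op X) :
    bridge S T g f (R + R') = bridge S T g f R + bridge S T g f R' := by
  simp only [bridge, vecSlice, opTensor_add_left, mul_add, add_mul, add_comp, comp_add]

theorem continuous_bridge (S T : Op (X × X)) (g f : L2 X) : Continuous (bridge S T g f) := by
  have h : Continuous fun R : Op X => (opTensor R 1 : Op (X × (X × X))) :=
    (opTensorL.flip (1 : Op (X × X))).continuous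
  exact continuous_const.clm_comp
    (((continuous_const.mul h).mul continuous_const).clm_comp continuous_const)

/-- A rank-one operator $|u\rangle\langle\bar v|$ on the sliced leg cuts the slice into the product
of a slice of $T_{13}$ and a slice of $S_{12}$, which live on different legs. -/
theorem bridge_hsOp_tmul (S T : Op (X × X)) (g f u v : L2 X) :
    bridge S T g f (hsOp (tmul u v)) = opTensor (vecSlice S (star v) f) (vecSlice T g u) := by
  have h : (opTensor (hsOp (tmul u v)) 1 : Op (X × (X × X))) =
      tmulLeft u ∘L adjoint (tmulLeft (star v)) := ext_tmul fun a b => by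
    rw [comp_apply, opTensor_tmul, hsOp_tmul_apply, adjoint_tmulLeft_tmul, map_smul,
      tmul_smul_left]; rfl
  calc bridge S T g f (hsOp (tmul u v))
      = vecSlice (tri13 T) g u * vecSlice (tri12 S) (star v) f := by rw [bridge, h]; rfl
    _ = _ := by rw [vecSlice_tri12, vecSlice_tri13, opTensor_mul, one_mul, mul_one]

theorem adjoint_insertFst_comp_leg24 (T : Op (X × X)) (g : L2 X) :
    adjoint (insertFst g) ∘L leg24 T = tri13 T ∘L adjoint (insertFst g) := by
  have h := congrArg adjoint (leg24_comp_insertFst (star T) g)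
  rw [adjoint_comp, adjoint_comp] at h
  have h1 : adjoint (leg24 (star T)) = leg24 T := by
    rw [← star_leg24, ← star_eq_adjoint, star_star]
  have h2 : adjoint (tri13 (star T)) = tri13 T := by
    rw [← star_tri13, ← star_eq_adjoint, star_star]
  rw [h1, h2] at h
  exact h

/-- $S_{13}$ ignores $f'$ in leg 2, and $T_{24}$ ignores $g$ in leg 1. Between them $W_{12}$
receives leg 1 and delivers leg 2, so it acts as a single operator joining the slices of $S$ and
$T$. -/
theorem vecSlice_eq_bridge (S T W : Op (X × X)) (g g' f f' : L2 X) :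
    vecSlice (leg24 T * leg12 W * leg13 S) (tmul g g') (tmul f f') =
      bridge S T g' f (adjoint (tmulLeft g) ∘L W ∘L tmulRight f') := by
  ext1 Θ
  have h1 := fun Ψ => congr($(adjoint_insertFst_comp_leg24 T g) Ψ)
  have h2 := fun Ψ => congr($(leg13_comp_insertSnd S f') Ψ)
  have h3 := fun Ψ => congr($(adjoint_insertFst_comp W g f') Ψ)
  simp only [comp_apply] at h1 h2 h3
  simp only [bridge, vecSlice, tmulLeft_tmul_eq_insertFst g, tmulLeft_tmul_eq_insertSnd f,
    adjoint_comp, mul_def, comp_apply, leg12]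
  rw [h2, h1, h3]

end Insertion

/-! ### Spatial tensor products and the slices of the double. -/

section SpatialTensor

variable {X Y : Type*} [MeasureSpace X] [MeasureSpace Y]
  [SigmaFinite (volume : Measure X)] [SigmaFinite (volume : Measure Y)]

theorem opTensor_mem_of_mem_closure {s : Set (Op X)} {t : Set (Op Y)}
    {N : Submodule ℂ (Op (X × Y))} (hN : IsClosed (N : Set (Op (X × Y))))
    (h : ∀ a ∈ s, ∀ b ∈ t, opTensor a b ∈ N) {a : Op X} {b : Op Y}
    (ha : a ∈ (Submodule.span ℂ s).topologicalClosure)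
    (hb : b ∈ (Submodule.span ℂ t).topologicalClosure) : opTensor a b ∈ N := by
  have key : ∀ b ∈ t, opTensor a b ∈ N := fun b hb => by
    have : (Submodule.span ℂ s).topologicalClosure ≤ N.comap (opTensorL.flip b).toLinearMap :=
      Submodule.topologicalClosure_minimal _ (Submodule.span_le.2 fun a ha => h a ha b hb)
        (hN.preimage (opTensorL.flip b).continuous)
    exact this ha
  have : (Submodule.span ℂ t).topologicalClosure ≤ N.comap (opTensorL a).toLinearMap :=
    Submodule.topologicalClosure_minimal _ (Submodule.span_le.2 key)
      (hN.preimage (opTensorL a).continuous)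
  exact this hb

/-- The spatial tensor product of C*-algebras is a C*-algebra. -/
theorem isConcreteCStarAlgebra_spatialTensor {A : Set (Op X)} {B : Set (Op Y)}
    (hA : IsConcreteCStarAlgebra A) (hB : IsConcreteCStarAlgebra B) :
    IsConcreteCStarAlgebra (spatialTensor A B) := by
  obtain ⟨-, A, rfl⟩ := hA
  obtain ⟨-, B, rfl⟩ := hB
  refine isConcreteCStarAlgebra_span ?_ ?_
  · rintro _ _ ⟨a, ha, b, hb, rfl⟩ ⟨a', ha', b', hb', rfl⟩
    rw [opTensor_mul]
    exact Submodule.le_topologicalClosure _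
      (Submodule.subset_span ⟨_, mul_mem ha ha', _, mul_mem hb hb', rfl⟩)
  · rintro _ ⟨a, ha, b, hb, rfl⟩
    rw [star_opTensor]
    exact Submodule.le_topologicalClosure _
      (Submodule.subset_span ⟨_, star_mem ha, _, star_mem hb, rfl⟩)

end SpatialTensor

section Double

variable {X : Type*} [MeasureSpace X] [SigmaFinite (volume : Measure X)]

/-- The left slices of `Z₁₂ Y₂₄ Z₁₂* X₁₃` are the tensor products of the left slices of `X` and
of `Y`, provided that the operators `(⟨g| ⊗ 1) Z* (1 ⊗ |f⟩)` exhaust the Hilbert–Schmidt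
operators. -/
theorem leftSliceClosure_double (S T Z V : Op (X × X)) (hZ : star Z * Z = 1) (hV : V * star V = 1)
    (hreg : ∀ g f : L2 X, adjoint (tmulLeft g) ∘L star Z ∘L tmulRight f =
      hsOp (V (tmul (star g) f))) :
    leftSliceClosure (leg12 Z * leg24 T * star (leg12 Z) * leg13 S) =
      spatialTensor (leftSliceClosure S) (leftSliceClosure T) := by
  set D := leg12 Z * leg24 T * star (leg12 Z) * leg13 S with hD
  -- The leftmost factor $Z_{12}$ becomes $Z^*$ on the bra vector.
  have hslice : ∀ Ψ Φ, vecSlice D Ψ Φ =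
      vecSlice (leg24 T * leg12 (star Z) * leg13 S) (star Z Ψ) Φ := fun Ψ Φ => by
    rw [hD, mul_assoc, mul_assoc, leg12, vecSlice_mul_left, one_mul, star_opTensor, star_one,
      ← mul_assoc]; rfl
  -- Choosing the bra vector $Z(g\otimes g')$ undoes that $Z^*$, because $Z^*Z=1$.
  have hbridge : ∀ g g' f f', vecSlice D (Z (tmul g g')) (tmul f f') =
      bridge S T g' f (hsOp (V (tmul (star g) f'))) := fun g g' f f' => by
    have h1 : star Z (Z (tmul g g')) = tmul g g' := congr($hZ (tmul g g'))
    rw [hslice, h1, ← hreg]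
    exact vecSlice_eq_bridge S T (star Z) g g' f f'
  rw [leftSliceClosure_eq, leftSliceClosure_eq, leftSliceClosure_eq]
  refine subset_antisymm ?_ ?_
  · set N := (Submodule.span ℂ {R : Op (X × X) | ∃ a ∈ ((sliceSpan S).topologicalClosure : Set _),
      ∃ b ∈ ((sliceSpan T).topologicalClosure : Set _), R = opTensor a b}).topologicalClosure
      with hN
    have hcl : IsClosed (N : Set (Op (X × X))) := Submodule.isClosed_topologicalClosure _
    -- Finite-rank kernels give sums of elementary tensors; the bridge depends continuously on the
    -- kernel, so every kernel is covered.
    have hk : ∀ g f k, bridge S T g f (hsOp k) ∈ N := fun g f k => by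
      refine tmul_induction (p := fun k => bridge S T g f (hsOp k) ∈ N)
        (hcl.preimage ((continuous_bridge S T g f).comp hsOp.continuous))
        (fun a b ha hb => ?_) (fun u v => ?_) k
      · rw [map_add, bridge_add]; exact add_mem ha hb
      · rw [bridge_hsOp_tmul]
        exact Submodule.le_topologicalClosure _ (Submodule.subset_span
          ⟨_, Submodule.le_topologicalClosure _ (vecSlice_mem S _ _),
            _, Submodule.le_topologicalClosure _ (vecSlice_mem T _ _), rfl⟩)
    refine Submodule.topologicalClosure_minimal _ (Submodule.span_le.2 ?_) hcl
    rintro _ ⟨Ψ, Φ, rfl⟩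
    rw [hslice]
    set W := leg24 T * leg12 (star Z) * leg13 S
    have hc := continuous_vecSlice W
    refine tmul_induction (p := fun Ψ => vecSlice W Ψ Φ ∈ N)
      (hcl.preimage (hc.comp (Continuous.prodMk_left Φ)))
      (fun a b ha hb => by rw [vecSlice_add_left]; exact add_mem ha hb) (fun g g' => ?_) _
    refine tmul_induction (p := fun Φ => vecSlice W (tmul g g') Φ ∈ N)
      (hcl.preimage (hc.comp (Continuous.prodMk_right (tmul g g'))))
      (fun a b ha hb => by rw [vecSlice_add_right]; exact add_mem ha hb) (fun f f' => ?_) Φ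
    rw [vecSlice_eq_bridge, hreg]
    exact hk _ _ _
  · set N := (sliceSpan D).topologicalClosure with hN
    have hcl : IsClosed (N : Set (Op (X × X))) := Submodule.isClosed_topologicalClosure _
    refine Submodule.topologicalClosure_minimal _ (Submodule.span_le.2 ?_) hcl
    rintro _ ⟨a, ha, b, hb, rfl⟩
    refine opTensor_mem_of_mem_closure hcl ?_ ha hb
    rintro _ ⟨v, f, rfl⟩ _ ⟨g, u, rfl⟩
    have hk : ∀ k, bridge S T g f (hsOp (V k)) ∈ N := fun k => by
      refine tmul_induction (p := fun k => bridge S T g f (hsOp (V k)) ∈ N)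
        (hcl.preimage ((continuous_bridge S T g f).comp (hsOp.continuous.comp V.continuous)))
        (fun a b ha hb => ?_) (fun h h' => ?_) k
      · rw [map_add, map_add, bridge_add]; exact add_mem ha hb
      · have := hbridge (star h) g f h'
        rw [star_star] at this
        rw [← this]
        exact Submodule.le_topologicalClosure _ (vecSlice_mem D _ _)
    -- $VV^*=1$ makes every kernel attainable. The kernel $u\otimes\bar v$ is the one whose bridge
    -- is the prescribed elementary tensor.
    have h1 : V (star V (tmul u (star v))) = tmul u (star v) := congr($hV (tmul u (star v)))
    have := hk (star V (tmul u (star v)))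
    rwa [h1, bridge_hsOp_tmul, star_star] at this

end Double

/-! ### Calculus of weighted compositions. -/

section WeightedComposition

variable {X Y Z : Type*} [MeasureSpace X] [MeasureSpace Y] [MeasureSpace Z]

/-- `T` is the isometry `ξ ↦ w · (ξ ∘ φ)` from `L²(X)` to `L²(Y)`. -/
structure IsWC (T : L2 X →L[ℂ] L2 Y) (φ : Y → X) (w : Y → ℂ) : Prop where
  measurable_map : Measurable φ
  measurable_weight : Measurable w
  lintegral_eq : ∀ f : X → ℝ≥0∞, Measurable f → ∫⁻ y, ‖w y‖ₑ ^ 2 * f (φ y) = ∫⁻ x, f x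
  coeFn : ∀ ξ, T ξ =ᵐ[volume] fun y => w y * ξ (φ y)

theorem IsWeightedComp.isWC {φ : X → X} {w : X → ℂ} (h : IsWeightedComp φ w) :
    IsWC (weightedComp φ w h).toContinuousLinearMap φ w :=
  ⟨h.measurable_map, h.measurable_weight, h.lintegral_eq, coeFn_weightedComp φ w h⟩

theorem isWC_compOp {φ : Y → X} (h : MeasurePreserving φ) : IsWC (compOp φ h) φ (fun _ => 1) where
  measurable_map := h.measurable
  measurable_weight := measurable_const
  lintegral_eq f hf := by simpa using h.lintegral_comp hf
  coeFn ξ := by simpa using coeFn_compOp φ h ξ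

theorem isWC_one : IsWC (1 : Op X) id (fun _ => 1) where
  measurable_map := measurable_id
  measurable_weight := measurable_const
  lintegral_eq f _ := by simp
  coeFn ξ := by simp

namespace IsWC

variable {T T' : L2 X →L[ℂ] L2 Y} {φ φ' : Y → X} {w w' : Y → ℂ}

theorem isWeightedComp {T : Op X} {φ : X → X} {w : X → ℂ} (h : IsWC T φ w) :
    IsWeightedComp φ w :=
  ⟨h.measurable_map, h.measurable_weight, h.lintegral_eq⟩

/-- The change of variables formula, applied to the indicator of a null set, shows that $\varphi$
can enter it on a non-null set only where $w=0$. -/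
theorem ae_comp (h : IsWC T φ w) {P : X → Prop} (hP : ∀ᵐ x, P x) :
    ∀ᵐ y, w y = 0 ∨ P (φ y) := by
  obtain ⟨t, hts, ht, ht0⟩ := exists_measurable_superset_of_null (ae_iff.1 hP)
  have h1 := h.lintegral_eq (t.indicator 1) (measurable_one.indicator ht)
  rw [lintegral_indicator_one ht, ht0, lintegral_eq_zero_iff] at h1
  · filter_upwards [h1] with y hy
    by_contra! hc
    have : φ y ∈ t := hts hc.2
    simp [this, hc.1] at hy
  · exact (h.measurable_weight.enorm.pow_const 2).mul
      ((measurable_one.indicator ht).comp h.measurable_map)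

theorem coeFn_of_ae (h : IsWC T φ w) {ξ : L2 X} {f : X → ℂ} (hf : ξ =ᵐ[volume] f) :
    T ξ =ᵐ[volume] fun y => w y * f (φ y) := by
  filter_upwards [h.coeFn ξ, h.ae_comp hf] with y h1 h2
  rw [h1]
  rcases h2 with h2 | h2 <;> simp [h2]

theorem comp {S : L2 Y →L[ℂ] L2 Z} {ψ : Z → Y} {z : Z → ℂ} (hS : IsWC S ψ z) (hT : IsWC T φ w) :
    IsWC (S ∘L T) (fun p => φ (ψ p)) (fun p => z p * w (ψ p)) where
  measurable_map := hT.measurable_map.comp hS.measurable_map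
  measurable_weight := hS.measurable_weight.mul (hT.measurable_weight.comp hS.measurable_map)
  lintegral_eq f hf := by
    rw [← hT.lintegral_eq f hf, ← hS.lintegral_eq]
    · simp only [enorm_mul, mul_pow, mul_assoc]
    · exact (hT.measurable_weight.enorm.pow_const 2).mul (hf.comp hT.measurable_map)
  coeFn ξ := by
    filter_upwards [hS.coeFn_of_ae (hT.coeFn ξ)] with p hp
    rw [comp_apply, hp, mul_assoc]

theorem mul {S T : Op X} {ψ φ : X → X} {z w : X → ℂ} (hS : IsWC S ψ z) (hT : IsWC T φ w) :
    IsWC (S * T) (fun p => φ (ψ p)) (fun p => z p * w (ψ p)) :=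
  hS.comp hT

theorem congr (h : IsWC T φ w) (hφ : ∀ y, φ y = φ' y) (hw : ∀ y, w y = w' y) : IsWC T φ' w' := by
  rwa [← funext hφ, ← funext hw]

theorem eq (h : IsWC T φ w) (h' : IsWC T' φ' w') (hφ : ∀ y, φ y = φ' y) (hw : ∀ y, w y = w' y) :
    T = T' := by
  ext1 ξ
  apply Lp.ext
  filter_upwards [h.coeFn ξ, h'.coeFn ξ] with y h1 h2
  rw [h1, h2, hφ, hw]

theorem norm_apply (h : IsWC T φ w) (ξ : L2 X) : ‖T ξ‖ = ‖ξ‖ := by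
  have hm : Measurable ξ := (Lp.stronglyMeasurable ξ).measurable
  rw [Lp.norm_def, Lp.norm_def, eLpNorm_congr_ae (h.coeFn ξ),
    eLpNorm_eq_lintegral_rpow_enorm_toReal (by norm_num) (by norm_num),
    eLpNorm_eq_lintegral_rpow_enorm_toReal (by norm_num) (by norm_num)]
  congr 2
  have := h.lintegral_eq (fun x => ‖ξ x‖ₑ ^ 2) (hm.enorm.pow_const 2)
  simpa [mul_pow] using this

theorem adjoint_comp_self (h : IsWC T φ w) : adjoint T ∘L T = 1 :=
  (norm_map_iff_adjoint_comp_self T).1 h.norm_apply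

theorem star_mul_self {T : Op X} {φ : X → X} {w : X → ℂ} (h : IsWC T φ w) : star T * T = 1 :=
  h.adjoint_comp_self

theorem inner_map_map (h : IsWC T φ w) (ξ ζ : L2 X) : ⟪T ξ, T ζ⟫_ℂ = ⟪ξ, ζ⟫_ℂ := by
  rw [← adjoint_inner_right, ← comp_apply, h.adjoint_comp_self]; rfl

/-- The inverse of a weighted composition with an invertible change of variables. -/
theorem star_of_inverse {T : Op X} {φ ψ : X → X} {w : X → ℂ} (h : IsWC T φ w) (hψ : Measurable ψ)
    (h1 : ∀ x, ψ (φ x) = x) (hw : ∀ x, w x ≠ 0) :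
    IsWC (star T) ψ (fun x => (w (ψ x))⁻¹) ∧ T * star T = 1 := by
  have hS : IsWeightedComp ψ (fun x => (w (ψ x))⁻¹) := by
    refine ⟨hψ, (h.measurable_weight.comp hψ).inv, fun f hf => ?_⟩
    rw [← h.lintegral_eq (fun x => ‖(w (ψ x))⁻¹‖ₑ ^ 2 * f (ψ x))]
    · refine lintegral_congr fun x => ?_
      rw [h1, ← mul_assoc, ← mul_pow, ← enorm_mul, mul_inv_cancel₀ (hw x)]
      simp
    · exact ((h.measurable_weight.comp hψ).inv.enorm.pow_const 2).mul (hf.comp hψ)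
  -- A pointwise left inverse of $\varphi$ gives a right inverse of $T$; as $T^*T=1$, this right
  -- inverse must be $T^*$.
  have hTS : T * (weightedComp ψ _ hS).toContinuousLinearMap = 1 :=
    (h.mul hS.isWC).eq isWC_one (fun x => h1 x) fun x => by
      rw [h1]; exact mul_inv_cancel₀ (hw x)
  have he : star T = (weightedComp ψ _ hS).toContinuousLinearMap :=
    left_inv_eq_right_inv h.star_mul_self hTS
  rw [he]
  exact ⟨hS.isWC, hTS⟩

end IsWC

variable [SigmaFinite (volume : Measure X)] [SigmaFinite (volume : Measure Y)]
  [SigmaFinite (volume : Measure Z)]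

/-- A weighted composition on `X`, followed by a family of weighted compositions on `Y`. -/
theorem isWeightedComp_skew {φ : X → X} {w : X → ℂ} (h : IsWeightedComp φ w) {ψ : X × Y → Y}
    {z : X × Y → ℂ} (hψ : Measurable ψ) (hz : Measurable z)
    (hf : ∀ x, ∀ f : Y → ℝ≥0∞, Measurable f →
      ∫⁻ y, ‖z (x, y)‖ₑ ^ 2 * f (ψ (x, y)) = ∫⁻ y, f y) :
    IsWeightedComp (fun p : X × Y => (φ p.1, ψ p)) (fun p => w p.1 * z p) := by
  have hφ := h.measurable_map
  have hw := h.measurable_weight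
  refine ⟨by fun_prop, by fun_prop, fun f hfm => ?_⟩
  rw [Measure.volume_eq_prod, lintegral_prod _ (by fun_prop), lintegral_prod _ hfm.aemeasurable,
    ← h.lintegral_eq (fun x => ∫⁻ y, f (x, y)) hfm.lintegral_prod_right']
  refine lintegral_congr fun x => ?_
  have h1 := hf x (fun y => f (φ x, y)) (by fun_prop)
  rw [← h1, ← lintegral_const_mul _ (by fun_prop)]
  simp only [enorm_mul, mul_pow, mul_assoc]

theorem isWC_opTensor {S : Op X} {T : Op Y} {φ : X → X} {ψ : Y → Y} {w : X → ℂ} {z : Y → ℂ}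
    (hS : IsWC S φ w) (hT : IsWC T ψ z) :
    IsWC (opTensor S T) (fun p => (φ p.1, ψ p.2)) (fun p => w p.1 * z p.2) := by
  have hψ := hT.measurable_map
  have hz := hT.measurable_weight
  have h : IsWeightedComp (fun p : X × Y => (φ p.1, ψ p.2)) (fun p => w p.1 * z p.2) :=
    isWeightedComp_skew hS.isWeightedComp (ψ := fun p => ψ p.2) (z := fun p => z p.2)
      (by fun_prop) (by fun_prop) fun _ => hT.lintegral_eq
  have he : opTensor S T = (weightedComp _ _ h).toContinuousLinearMap := ext_tmul fun f g => by
    rw [opTensor_tmul]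
    apply Lp.ext
    filter_upwards [coeFn_tmul (S f) (T g), ae_fst (Y := Y) (hS.coeFn f),
      ae_snd (X := X) (hT.coeFn g), h.isWC.coeFn_of_ae (coeFn_tmul f g)] with p h1 h2 h3 h4
    rw [h1, h2, h3, h4]
    ring
  rw [he]
  exact h.isWC

theorem isWC_flipOp : IsWC (flipOp : Op (X × X)) Prod.swap (fun _ => 1) :=
  isWC_compOp Measure.measurePreserving_swap

theorem isWC_tri12 {T : Op (X × Y)} {φ : X × Y → X × Y} {w : X × Y → ℂ} (h : IsWC T φ w) :
    IsWC (tri12 T : Op (X × (Y × Z)))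
      (fun p => ((φ (p.1, p.2.1)).1, ((φ (p.1, p.2.1)).2, p.2.2))) (fun p => w (p.1, p.2.1)) := by
  refine ((isWC_compOp _).comp ((isWC_opTensor h isWC_one).comp (isWC_compOp _))).congr
    (fun p => rfl) fun p => ?_
  change 1 * (w (p.1, p.2.1) * 1 * 1) = _
  ring

theorem isWC_tri13 {T : Op (X × X)} {φ : X × X → X × X} {w : X × X → ℂ} (h : IsWC T φ w) :
    IsWC (tri13 T)
      (fun p => ((φ (p.1, p.2.2)).1, (p.2.1, (φ (p.1, p.2.2)).2))) (fun p => w (p.1, p.2.2)) := by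
  have hf := isWC_opTensor (isWC_one (X := X)) (isWC_flipOp (X := X))
  refine ((hf.mul (isWC_tri12 h)).mul hf).congr (fun p => rfl) fun p => ?_
  simp

theorem isWC_opTensor_one {T : Op (X × X)} {φ : X × X → X × X} {w : X × X → ℂ} (h : IsWC T φ w) :
    IsWC (opTensor (1 : Op X) T) (fun p => (p.1, φ p.2)) (fun p => w p.2) :=
  (isWC_opTensor isWC_one h).congr (fun _ => rfl) fun _ => one_mul _

/-- The pentagon equation of a weighted composition, checked on points. -/
theorem pentagon_of_isWC {T : Op (X × X)} {φ : X × X → X × X} {w : X × X → ℂ} (h : IsWC T φ w)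
    (hφ : ∀ a b c : X,
      let p := φ (a, b)
      let q := φ (p.1, c)
      let r := φ (p.2, q.2)
      let s := φ (b, c)
      let t := φ (a, s.1)
      q.1 = t.1 ∧ r.1 = t.2 ∧ r.2 = s.2 ∧ w (a, b) * w (p.1, c) * w (p.2, q.2) =
        w (b, c) * w (a, s.1)) :
    tri12 T * tri13 T * opTensor 1 T = opTensor 1 T * tri12 T :=
  (((isWC_tri12 h).mul (isWC_tri13 h)).mul (isWC_opTensor_one h)).eq
    ((isWC_opTensor_one h).mul (isWC_tri12 h))
    (fun p => by
      obtain ⟨h1, h2, h3, -⟩ := hφ p.1 p.2.1 p.2.2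
      exact Prod.ext h1 (Prod.ext h2 h3))
    (fun p => (hφ p.1 p.2.1 p.2.2).2.2.2)

end WeightedComposition

/-! ### The operators $X$ and $Y$ of the quantum Heisenberg group. -/

section QuantumHeisenberg

theorem e_add (s t : ℝ) : e (s + t) = e s * e t := by
  rw [e, e, e, ← Complex.exp_add]
  push_cast
  ring_nf

theorem e_zero : e 0 = 1 := by simp [e]

theorem inv_e (t : ℝ) : (e t)⁻¹ = e (-t) := by
  refine (eq_inv_of_mul_eq_one_left ?_).symm
  rw [← e_add, neg_add_cancel, e_zero]

theorem conj_e (t : ℝ) : starRingEnd ℂ (e t) = e (-t) := by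
  rw [← inv_e, Complex.inv_def, Complex.normSq_eq_norm_sq, norm_e]
  simp

theorem e_ne_zero (t : ℝ) : e t ≠ 0 := fun h => by simpa [h] using norm_e t

/-- This cocycle identity of $\eta_\lambda$, with bilinearity of $\beta$, is what makes the phases
match below. -/
theorem eta_add (lam r s : ℝ) :
    eta lam (r + s) = eta lam s + Real.exp (lam * s) ^ 2 * eta lam r := by
  unfold eta
  split_ifs with h
  · simp [h, add_comm]
  · rw [← Real.exp_nat_mul, mul_add, Real.exp_add]
    field_simp
    push_cast
    ring_nf

theorem eta_zero (lam : ℝ) : eta lam 0 = 0 := by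
  unfold eta
  split_ifs <;> simp

theorem eta_neg (lam r : ℝ) : eta lam (-r) = -(((Real.exp (lam * r))⁻¹) ^ 2 * eta lam r) := by
  have h := eta_add lam r (-r)
  rw [add_neg_cancel, eta_zero, mul_neg, Real.exp_neg] at h
  linarith

theorem eta_add' (lam r s : ℝ) :
    eta lam (r + s) = eta lam r + Real.exp (lam * r) ^ 2 * eta lam s := by
  rw [add_comm, eta_add]

theorem eta_sub (lam r s : ℝ) : eta lam (r - s) =
    eta lam r - Real.exp (lam * r) ^ 2 * ((Real.exp (lam * s))⁻¹ ^ 2 * eta lam s) := by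
  rw [sub_eq_add_neg, eta_add', eta_neg, mul_neg, ← sub_eq_add_neg]

theorem weight_mul (a b s t : ℝ) : (a * e s) * (b * e t) = (a * b : ℝ) * e (s + t) := by
  rw [e_add]
  push_cast
  ring

theorem weight_eq_e {a s t : ℝ} (h : a = 1) (h' : s = t) : (a : ℂ) * e s = e t := by
  rw [h, h', Complex.ofReal_one, one_mul]

variable (n : ℕ) (lam : ℝ)

theorem isWC_UA : IsWC (UA n lam) (mapUA n lam) (weightUA n lam) :=
  (isWeightedComp_UA n lam).isWC

theorem isWC_opJ : IsWC (opJ n lam) (mapJ n lam) (weightJ n lam) :=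
  (isWeightedComp_J n lam).isWC

theorem opJ_mul_opJ : opJ n lam * opJ n lam = 1 := by
  refine ((isWC_opJ n lam).mul (isWC_opJ n lam)).eq isWC_one (fun p => ?_) fun p => ?_
  · refine Prod.ext ?_ (neg_neg _)
    simp only [mapJ, id, smul_neg, neg_neg, smul_smul, ← Real.exp_add]
    simp
  · simp only [weightJ, mapJ]
    rw [weight_mul, ← e_zero]
    refine weight_eq_e ?_ ?_
    · rw [← mul_pow, ← Real.exp_add]
      simp
    · simp only [Prod.fst_neg, Prod.snd_neg, Prod.smul_fst, Prod.smul_snd, inner_neg_neg,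
        real_inner_smul_left, real_inner_smul_right, eta_neg]
      field_simp
      ring

theorem star_opJ : star (opJ n lam) = opJ n lam :=
  left_inv_eq_right_inv (isWC_opJ n lam).star_mul_self (opJ_mul_opJ n lam)

/-- The operator `(j ⊗ 1) U_A (j ⊗ 1)`. -/
def conjUA : Op (Pt n × Pt n) := opTensor (opJ n lam) 1 * UA n lam * opTensor (opJ n lam) 1

/-- The dilation factors of $U_A$ and of the two copies of $j$ multiply to 1, and their phases
collapse to a single term. -/
theorem isWC_conjUA : IsWC (conjUA n lam)
    (fun p => ((p.1.1, p.1.2 - p.2.2), (p.2.1 + Real.exp (lam * (p.1.2 - p.2.2)) • p.1.1, p.2.2)))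
    (fun p => e (eta lam p.2.2 * (Real.exp (lam * (p.1.2 - p.2.2)) * inner ℝ p.1.1.1 p.2.1.2))) := by
  have hJ := isWC_opTensor (isWC_opJ n lam) (isWC_one (X := Pt n))
  refine ((hJ.mul (isWC_UA n lam)).mul hJ).congr ?_ ?_
  · rintro ⟨⟨v, r⟩, ⟨v', r'⟩⟩
    simp only [mapUA, mapJ, id, smul_neg, smul_smul, ← Real.exp_add, neg_neg, sub_neg_eq_add]
    congr 3
    · convert one_smul ℝ v
      rw [Real.exp_eq_one_iff]; ring
    · ring
    · congr 2; ring
  · rintro ⟨⟨⟨x, y⟩, r⟩, ⟨⟨x', y'⟩, r'⟩⟩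
    simp only [mapUA, mapJ, weightUA, weightJ, id, mul_one]
    rw [weight_mul, weight_mul]
    refine weight_eq_e ?_ ?_
    · rw [← mul_pow, ← mul_pow, ← Real.exp_add, ← Real.exp_add]
      ring_nf
      simp
    · simp only [Prod.fst_neg, Prod.snd_neg, Prod.smul_fst, Prod.smul_snd, smul_neg,
        inner_neg_left, inner_neg_right, inner_sub_right,
        real_inner_smul_left, real_inner_smul_right, eta_neg, eta_add, neg_mul, mul_neg,
        mul_sub, Real.exp_neg, Real.exp_sub]
      field_simp
      ring

theorem opX_eq : opX n lam = star (conjUA n lam) := by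
  have hf := flipOp_mul_flipOp (X := Pt n)
  have h : UAhat n lam = flipOp * conjUA n lam * flipOp := by
    simp only [UAhat, conjUA, mul_assoc]
  rw [opX, h, star_mul, star_mul, star_flipOp]
  simp only [← mul_assoc]
  rw [hf, one_mul, mul_assoc, hf, mul_one]

theorem opY_eq : opY n lam = flipOp * conjUA n lam * flipOp := by
  rw [opY, opX_eq, star_star]

theorem isWC_opX : IsWC (opX n lam)
    (fun p => ((p.1.1, p.1.2 + p.2.2), (p.2.1 - Real.exp (lam * p.1.2) • p.1.1, p.2.2)))
    (fun p => e (-(eta lam p.2.2 * (Real.exp (lam * p.1.2) *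
      (inner ℝ p.1.1.1 p.2.1.2 - Real.exp (lam * p.1.2) * inner ℝ p.1.1.1 p.1.1.2))))) := by
  have h := (isWC_conjUA n lam).star_of_inverse
    (ψ := fun p => ((p.1.1, p.1.2 + p.2.2), (p.2.1 - Real.exp (lam * p.1.2) • p.1.1, p.2.2)))
    (by fun_prop) (fun p => by simp) (fun p => e_ne_zero _)
  rw [opX_eq]
  refine h.1.congr (fun p => rfl) fun p => ?_
  simp only [inv_e, add_sub_cancel_right, Prod.snd_sub, Prod.smul_snd, inner_sub_right,
    real_inner_smul_right]

theorem isWC_opY : IsWC (opY n lam)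
    (fun p => ((p.1.1 + Real.exp (lam * (p.2.2 - p.1.2)) • p.2.1, p.1.2), (p.2.1, p.2.2 - p.1.2)))
    (fun p => e (eta lam p.1.2 * (Real.exp (lam * (p.2.2 - p.1.2)) *
      inner ℝ p.2.1.1 p.1.1.2))) := by
  rw [opY_eq]
  refine ((isWC_flipOp.mul (isWC_conjUA n lam)).mul isWC_flipOp).congr (fun p => rfl) fun p => ?_
  simp

theorem pentagon_opX :
    tri12 (opX n lam) * tri13 (opX n lam) * opTensor 1 (opX n lam) =
      opTensor 1 (opX n lam) * tri12 (opX n lam) := by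
  refine pentagon_of_isWC (isWC_opX n lam) ?_
  rintro ⟨⟨x, y⟩, r⟩ ⟨⟨x', y'⟩, r'⟩ ⟨⟨x'', y''⟩, r''⟩
  refine ⟨?_, ?_, ?_, ?_⟩
  · simp only [add_assoc]
  · rfl
  · simp only [mul_add, Real.exp_add, smul_sub, smul_smul]
    congr 1
    rw [mul_comm (Real.exp (lam * r'))]
    abel
  -- The phases agree once their real exponents do, which is an identity in $\eta_\lambda$,
  -- exponentials and inner products.
  · simp only [← e_add]
    congr 1
    simp only [Prod.fst_sub, Prod.snd_sub, Prod.smul_fst, Prod.smul_snd,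
      inner_sub_right, inner_sub_left,
      real_inner_smul_left, real_inner_smul_right, eta_add', mul_add, Real.exp_add]
    ring

theorem pentagon_opY :
    tri12 (opY n lam) * tri13 (opY n lam) * opTensor 1 (opY n lam) =
      opTensor 1 (opY n lam) * tri12 (opY n lam) := by
  refine pentagon_of_isWC (isWC_opY n lam) ?_
  rintro ⟨⟨x, y⟩, r⟩ ⟨⟨x', y'⟩, r'⟩ ⟨⟨x'', y''⟩, r''⟩
  refine ⟨?_, ?_, ?_, ?_⟩
  · simp only [mul_sub, Real.exp_sub, smul_add, smul_smul]
    refine Prod.ext ?_ rfl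
    rw [add_assoc]
    congr 3
    field_simp
  · simp only [sub_sub_sub_cancel_right]
  · simp only [sub_sub_sub_cancel_right]
  · simp only [← e_add]
    congr 1
    simp only [Prod.fst_add, Prod.snd_add, Prod.smul_fst, Prod.smul_snd,
      inner_add_right, inner_add_left,
      real_inner_smul_left, real_inner_smul_right, eta_sub, mul_sub, Real.exp_sub]
    field_simp
    ring

end QuantumHeisenberg

/-! ### Pointwise criteria for the involution and for Hilbert–Schmidt slices. -/

section TransposeAndRegularity

variable {X : Type*} [MeasureSpace X] [SigmaFinite (volume : Measure X)]

theorem IsWeightedComp.congr_weight {φ : X → X} {w w' : X → ℂ} (h : IsWeightedComp φ w)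
    (hm : Measurable w') (hw : ∀ x, ‖w' x‖ = ‖w x‖) : IsWeightedComp φ w' := by
  refine ⟨h.measurable_map, hm, fun f hf => ?_⟩
  rw [← h.lintegral_eq f hf]
  simp only [← ofReal_norm, hw]

/-- A criterion for the family of vector slices of a weighted composition to be stable under the
involution, in terms of an antiunitary `f ↦ C (conj f)` and a change of variables `S`. -/
theorem star_vecSlice_of_isWC {T S : Op (X × X)} {C : Op X} {φ σ : X × X → X × X} {κ : X → X}
    {w u : X × X → ℂ} {z : X → ℂ} (hT : IsWC T φ w) (hS : IsWC S σ u) (hC : IsWC C κ z)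
    (h1 : ∀ p, (σ p).2 = (φ p).2) (h2 : ∀ p, (φ (σ p)).2 = p.2) (h3 : ∀ p, κ (σ p).1 = p.1)
    (h4 : ∀ p, κ (φ (σ p)).1 = (φ p).1)
    (h5 : ∀ p, starRingEnd ℂ (u p * z (σ p).1) * (u p * w (σ p) * z (φ (σ p)).1) =
      starRingEnd ℂ (w p)) (g f : L2 X) :
    star (vecSlice T g f) = vecSlice T (C (star g)) (C (star f)) := by
  have hconj : ∀ f a : L2 X, tmul (C (star f)) a =ᵐ[volume]
      fun p : X × X => z p.1 * starRingEnd ℂ (f (κ p.1)) * a p.2 := fun f a => by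
    filter_upwards [coeFn_tmul (C (star f)) a,
      ae_fst (Y := X) (hC.coeFn_of_ae (Lp.coeFn_star f))] with p h h'
    rw [h, h']; rfl
  ext1 b
  refine ext_inner_left ℂ fun a => ?_
  rw [star_eq_adjoint, adjoint_inner_right]
  simp only [vecSlice, comp_apply, tmulLeft_apply, adjoint_inner_right, adjoint_inner_left]
  -- Applying the isometry $S$ to both vectors on one side is the change of variables $\sigma$;
  -- after it the two integrands agree pointwise.
  rw [← hS.inner_map_map (tmul _ a), ← comp_apply S T, L2.inner_def, L2.inner_def]
  refine integral_congr_ae ?_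
  filter_upwards [hT.coeFn_of_ae (coeFn_tmul f a), coeFn_tmul g b,
    hS.coeFn_of_ae (hconj g a), (hS.comp hT).coeFn_of_ae (hconj f b)] with p e1 e2 e3 e4
  rw [e1, e2, e3, e4, h1, h2, h3, h4]
  simp only [RCLike.inner_apply, map_mul, starRingEnd_self_apply] at h5 ⊢
  rw [← h5 p]
  ring

/-- The operators `(⟨g| ⊗ 1) T (1 ⊗ |f⟩)` of a weighted composition have Hilbert–Schmidt
kernels. -/
theorem slice_eq_hsOp {T S R : Op (X × X)} {φ : X × X → X × X} {w : X × X → ℂ}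
    (hT : IsWC T φ w) (hS : IsWC S (fun p => (p.2, (φ p).1)) (fun _ => 1))
    (hR : IsWC R (fun p => (p.1, (φ p).2)) w) (g f : L2 X) :
    adjoint (tmulLeft g) ∘L T ∘L tmulRight f = hsOp ((star S * R) (tmul (star g) f)) := by
  have hconj : ∀ f a : L2 X, tmul a (star f) =ᵐ[volume]
      fun p : X × X => a p.1 * starRingEnd ℂ (f p.2) := fun f a => by
    filter_upwards [coeFn_tmul a (star f), ae_snd (X := X) (Lp.coeFn_star f)] with p h h'
    rw [h, h']; rfl
  have hconj' : ∀ f a : L2 X, tmul (star f) a =ᵐ[volume]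
      fun p : X × X => starRingEnd ℂ (f p.1) * a p.2 := fun f a => by
    filter_upwards [coeFn_tmul (star f) a, ae_fst (Y := X) (Lp.coeFn_star f)] with p h h'
    rw [h, h']; rfl
  ext1 c
  refine ext_inner_left ℂ fun a => ?_
  rw [inner_hsOp, mul_def, comp_apply, comp_apply, comp_apply, star_eq_adjoint,
    adjoint_inner_right, adjoint_inner_right, tmulLeft_apply, tmulRight_apply, L2.inner_def,
    L2.inner_def]
  refine integral_congr_ae ?_
  -- The integrand is $w\,\overline{g(p_1)a(p_2)}\,c(\varphi_1)f(\varphi_2)$. Grouping $a,c$ against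
  -- $g,f$ turns it into that of $\langle S(a\otimes\bar c),R(\bar g\otimes f)\rangle$.
  filter_upwards [hT.coeFn_of_ae (coeFn_tmul c f), coeFn_tmul g a,
    hS.coeFn_of_ae (hconj c a), hR.coeFn_of_ae (hconj' g f)] with p e1 e2 e3 e4
  rw [e1, e2, e3, e4]
  simp only [RCLike.inner_apply, map_mul, starRingEnd_self_apply, one_mul]
  ring

end TransposeAndRegularity

/-! ### Stability of the slices of $X$ and $Y$ under the involution. -/

section QuantumHeisenberg

variable (n : ℕ) (lam : ℝ)

/-- Negative $c$ is allowed so that $v\mapsto-v$ is covered as well. -/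
theorem lintegral_affine (c : ℝ) (hc : c ≠ 0)
    (u : EuclideanSpace ℝ (Fin n) × EuclideanSpace ℝ (Fin n))
    (f : EuclideanSpace ℝ (Fin n) × EuclideanSpace ℝ (Fin n) → ℝ≥0∞) (hf : Measurable f) :
    ∫⁻ v, ENNReal.ofReal (|c| ^ n) ^ 2 * f (c • v + u) = ∫⁻ v, f v := by
  have ht : ∀ f : EuclideanSpace ℝ (Fin n) × EuclideanSpace ℝ (Fin n) → ℝ≥0∞,
      ∫⁻ v, f (v + u) = ∫⁻ v, f v := fun f => by
    simpa using lintegral_translate n f (-u)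
  rcases lt_or_gt_of_ne hc with h | h
  · have h1 := lintegral_dilate n |c| (abs_pos.2 hc) (fun v => f (-v + u)) (by fun_prop)
    rw [lintegral_reflect n (fun v => f (v + u)), ht] at h1
    rw [← h1]
    refine lintegral_congr fun v => ?_
    rw [abs_of_neg h, ← neg_smul, neg_neg]
  · rw [abs_of_pos h, lintegral_dilate n c h (fun v => f (v + u)) (by fun_prop), ht]

theorem isWeightedComp_affine {c : ℝ → ℝ} (hc : Measurable c) (hc0 : ∀ r, c r ≠ 0)
    {u : ℝ → EuclideanSpace ℝ (Fin n) × EuclideanSpace ℝ (Fin n)} (hu : Measurable u)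
    {ρ : ℝ → ℝ} (hρ : MeasurePreserving ρ) :
    IsWeightedComp (fun p : Pt n => (c p.2 • p.1 + u p.2, ρ p.2))
      (fun p => ((|c p.2| ^ n : ℝ) : ℂ)) := by
  have hm := hρ.measurable
  refine ⟨by fun_prop, by fun_prop, fun f hf => ?_⟩
  have hw : ∀ r, ‖((|c r| ^ n : ℝ) : ℂ)‖ₑ = ENNReal.ofReal (|c r| ^ n) := fun r => by
    rw [← ofReal_norm, Complex.norm_real, Real.norm_of_nonneg (by positivity)]
  rw [Measure.volume_eq_prod, lintegral_prod_symm _ (by fun_prop),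
    lintegral_prod_symm _ hf.aemeasurable, ← hρ.lintegral_comp hf.lintegral_prod_left']
  refine lintegral_congr fun r => ?_
  simp only [hw]
  exact lintegral_affine n (c r) (hc0 r) (u r) (fun v => f (v, ρ r)) (by fun_prop)

theorem lintegral_translate_Pt (u : EuclideanSpace ℝ (Fin n) × EuclideanSpace ℝ (Fin n)) (s : ℝ)
    (f : Pt n → ℝ≥0∞) (hf : Measurable f) :
    ∫⁻ p : Pt n, f (p.1 + u, p.2 + s) = ∫⁻ p, f p := by
  have h := (isWeightedComp_affine n (c := fun _ => 1) measurable_const (fun _ => one_ne_zero)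
    (u := fun _ => u) measurable_const (measurePreserving_add_right volume s)).lintegral_eq f hf
  simpa using h

theorem exists_star_vecSlice_opX (g f : L2 (Pt n)) :
    ∃ g' f', star (vecSlice (opX n lam) g f) = vecSlice (opX n lam) g' f' := by
  have hR : IsWeightedComp (fun p : Pt n => (-p.1, p.2)) (fun _ => 1) := by
    have h := (isWeightedComp_affine n (c := fun _ => -1) measurable_const (by simp)
      (u := fun _ => 0) measurable_const (MeasurePreserving.id volume))
    simpa using h
  have hC : IsWeightedComp (fun p : Pt n => (-p.1, p.2))
      (fun p => e (-(eta lam p.2 * inner ℝ p.1.1 p.1.2))) := by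
    have := measurable_e
    have := measurable_eta lam
    exact hR.congr_weight (by fun_prop) fun p => by simp [norm_e]
  -- The criterion dictates $\sigma$: its first component undoes the map of $C$, and its second is
  -- that of the map of $X$.
  have hS : IsWeightedComp (fun p : Pt n × Pt n =>
      ((-p.1.1, p.1.2), (p.2.1 - Real.exp (lam * p.1.2) • p.1.1, p.2.2)))
      (fun _ => 1) := by
    have h := isWeightedComp_skew hR (Y := Pt n)
      (ψ := fun p => (p.2.1 - Real.exp (lam * p.1.2) • p.1.1, p.2.2)) (z := fun _ => 1)
      (by fun_prop) measurable_const fun x f hf => by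
        simpa [sub_eq_add_neg] using
          lintegral_translate_Pt n (-(Real.exp (lam * x.2) • x.1)) 0 f hf
    simpa using h
  refine ⟨_, _, star_vecSlice_of_isWC (isWC_opX n lam) hS.isWC hC.isWC (fun p => rfl)
    (fun p => ?_) (fun p => ?_) (fun p => ?_) (fun p => ?_) g f⟩
  · simp
  · simp
  · simp
  · obtain ⟨⟨⟨x, y⟩, r⟩, ⟨⟨x', y'⟩, r'⟩⟩ := p
    simp only [one_mul, conj_e, ← e_add]
    congr 1
    simp only [Prod.fst_neg, Prod.snd_neg, inner_neg_left, inner_neg_right,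
      Prod.snd_sub, Prod.smul_snd, inner_sub_right, real_inner_smul_right, eta_add']
    ring

theorem exists_star_vecSlice_opY (g f : L2 (Pt n)) :
    ∃ g' f', star (vecSlice (opY n lam) g f) = vecSlice (opY n lam) g' f' := by
  have hC : IsWeightedComp (fun p : Pt n => (Real.exp (lam * p.2) • p.1, -p.2))
      (fun p => ((Real.exp (lam * p.2) ^ n : ℝ) : ℂ)) := by
    have h := (isWeightedComp_affine n (c := fun r => Real.exp (lam * r)) (by fun_prop)
      (fun r => (Real.exp_pos _).ne') (u := fun _ => 0) measurable_const
      (Measure.measurePreserving_neg volume))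
    simpa using h
  -- Again $\sigma$ is forced: the map of $C$ is an involution, used in the first component, and the
  -- second comes from the map of $Y$.
  have hS : IsWeightedComp (fun p : Pt n × Pt n =>
      ((Real.exp (lam * p.1.2) • p.1.1, -p.1.2), (p.2.1, p.2.2 - p.1.2)))
      (fun p => ((Real.exp (lam * p.1.2) ^ n : ℝ) : ℂ)) := by
    have h := isWeightedComp_skew hC (Y := Pt n)
      (ψ := fun p => (p.2.1, p.2.2 - p.1.2)) (z := fun _ => 1)
      (by fun_prop) measurable_const fun x f hf => by
        simpa [sub_eq_add_neg] using lintegral_translate_Pt n 0 (-x.2) f hf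
    simpa using h
  refine ⟨_, _, star_vecSlice_of_isWC (isWC_opY n lam) hS.isWC hC.isWC (fun p => rfl)
    (fun p => ?_) (fun p => ?_) (fun p => ?_) (fun p => ?_) g f⟩
  · simp
  · simp [smul_smul, ← Real.exp_add]
  · simp [smul_smul, ← Real.exp_add]
    ring_nf
  · obtain ⟨⟨⟨x, y⟩, r⟩, ⟨⟨x', y'⟩, r'⟩⟩ := p
    have h : ((Real.exp (lam * r) ^ n : ℝ) : ℂ) * ((Real.exp (lam * -r) ^ n : ℝ) : ℂ) = 1 := by
      rw [← Complex.ofReal_mul, ← mul_pow, ← Real.exp_add]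
      simp
    simp only [map_mul, Complex.conj_ofReal, conj_e]
    rw [h, one_mul, mul_right_comm, h, one_mul]
    congr 1
    simp only [Prod.smul_snd, real_inner_smul_right, eta_neg, mul_sub, Real.exp_sub, mul_neg,
      Real.exp_neg]
    field_simp

end QuantumHeisenberg

/-! ### Identification of the algebras and regularity of $Z$. -/

section Slices

variable {X : Type*} [MeasureSpace X] [SigmaFinite (volume : Measure X)]

theorem rightSliceClosure_eq (T : Op (X × X)) :
    rightSliceClosure T = leftSliceClosure (flipOp * T * flipOp) := by
  have hf : ∀ f : L2 X, (tmulRight f : L2 X →L[ℂ] L2 (X × X)) = flipOp ∘L tmulLeft f := fun f => by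
    ext1 g
    exact (flipOp_tmul f g).symm
  have h : ∀ ω, rightSlice ω T = leftSlice ω (flipOp * T * flipOp) := fun ω => by
    refine (leftSlice_eq_of_hasSum ?_).symm
    have h2 : ∀ g f : L2 X, adjoint (tmulRight g) ∘L T ∘L tmulRight f =
        vecSlice (flipOp * T * flipOp) g f := fun g f => by
      rw [hf, hf, adjoint_comp, ← star_eq_adjoint flipOp, star_flipOp]; rfl
    have h3 := hasSum_rightSlice ω T
    simp only [h2] at h3
    exact h3
  simp only [rightSliceClosure, leftSliceClosure, h]

theorem leftSliceClosure_star {T : Op (X × X)}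
    (hstar : ∀ g f, ∃ g' f', star (vecSlice T g f) = vecSlice T g' f') :
    leftSliceClosure (star T) = leftSliceClosure T := by
  rw [leftSliceClosure_eq, leftSliceClosure_eq, sliceSpan, sliceSpan]
  congr 3
  ext R
  constructor
  · rintro ⟨g, f, rfl⟩
    rw [← star_vecSlice]
    exact hstar f g
  · rintro ⟨g, f, rfl⟩
    obtain ⟨g', f', h⟩ := hstar g f
    exact ⟨f', g', by rw [← star_vecSlice, ← h, star_star]⟩

end Slices

section QuantumHeisenberg

variable (n : ℕ) (lam : ℝ)

theorem star_opX_mul_opX : star (opX n lam) * opX n lam = 1 := (isWC_opX n lam).star_mul_self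

theorem star_opY_mul_opY : star (opY n lam) * opY n lam = 1 := (isWC_opY n lam).star_mul_self

theorem opY_mul_star_opY : opY n lam * star (opY n lam) = 1 :=
  ((isWC_opY n lam).star_of_inverse
    (ψ := fun p => ((p.1.1 - Real.exp (lam * p.2.2) • p.2.1, p.1.2), (p.2.1, p.2.2 + p.1.2)))
    (by fun_prop) (fun p => by simp) (fun p => e_ne_zero _)).2

theorem isConcreteCStarAlgebra_opX : IsConcreteCStarAlgebra (leftSliceClosure (opX n lam)) :=
  isConcreteCStarAlgebra_of_pentagon (star_opX_mul_opX n lam) (pentagon_opX n lam)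
    (exists_star_vecSlice_opX n lam)

theorem isConcreteCStarAlgebra_opY : IsConcreteCStarAlgebra (leftSliceClosure (opY n lam)) :=
  isConcreteCStarAlgebra_of_pentagon (star_opY_mul_opY n lam) (pentagon_opY n lam)
    (exists_star_vecSlice_opY n lam)

/-- $X^*$ is $U_A$ conjugated by $j$ on the sliced leg, so the two have the same slices because $j$
is a bijection of the vectors; stability under the involution replaces $X^*$ by $X$. -/
theorem algA_eq : algA n lam = leftSliceClosure (opX n lam) := by
  have hJ : ∀ f, opJ n lam (opJ n lam f) = f := fun f => congr($(opJ_mul_opJ n lam) f)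
  have h : ∀ g f, vecSlice (star (opX n lam)) g f =
      vecSlice (UA n lam) (opJ n lam g) (opJ n lam f) := fun g f => by
    rw [opX_eq, star_star, conjUA, vecSlice_mul_right, vecSlice_mul_left, star_opJ, one_mul,
      mul_one]
  rw [algA, ← leftSliceClosure_star (exists_star_vecSlice_opX n lam), leftSliceClosure_eq,
    leftSliceClosure_eq, sliceSpan, sliceSpan]
  congr 3
  ext R
  constructor
  · rintro ⟨g, f, rfl⟩
    exact ⟨opJ n lam g, opJ n lam f, by rw [h, hJ, hJ]⟩
  · rintro ⟨g, f, rfl⟩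
    exact ⟨_, _, h g f⟩

theorem algAhatOp_eq : algAhatOp n lam = leftSliceClosure (opY n lam) := by
  have h : flipOp * opX n lam * flipOp = star (opY n lam) := by
    rw [opY, star_mul, star_mul, star_flipOp, star_star, mul_assoc]
  rw [algAhatOp, rightSliceClosure_eq, h, leftSliceClosure_star (exists_star_vecSlice_opY n lam)]

/-- The operator `(j ⊗ j) Y (j ⊗ j)`. -/
def conjY : Op (Pt n × Pt n) :=
  opTensor (opJ n lam) (opJ n lam) * opY n lam * opTensor (opJ n lam) (opJ n lam)

/-- The phase is left unspecified: regularity of $Z$ depends only on the change of variables and the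
modulus of the weight. -/
theorem exists_isWC_conjY : ∃ w : Pt n × Pt n → ℂ, IsWC (conjY n lam)
    (fun p => ((p.1.1 + p.2.1, p.1.2), (Real.exp (lam * p.1.2) • p.2.1, p.2.2 - p.1.2))) w ∧
    ∀ p, ‖w p‖ = Real.exp (lam * p.1.2) ^ n := by
  have hJ := isWC_opTensor (isWC_opJ n lam) (isWC_opJ n lam)
  refine ⟨_, ((hJ.mul (isWC_opY n lam)).mul hJ).congr ?_ fun p => rfl, ?_⟩
  · rintro ⟨⟨v, r⟩, ⟨v', r'⟩⟩
    have h1 : lam * -r + lam * r = 0 := by ring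
    have h2 : lam * (-r' - -r) + lam * r' = lam * r := by ring
    simp only [mapJ, smul_neg, smul_add, smul_smul, ← Real.exp_add, h1, h2, Real.exp_zero]
    refine Prod.ext (Prod.ext ?_ (neg_neg r)) (Prod.ext (neg_neg _) (by ring))
    simp only [one_smul]
    abel
  · rintro ⟨⟨v, r⟩, ⟨v', r'⟩⟩
    have : ∀ p, ‖weightJ n lam p‖ = Real.exp (lam * p.2) ^ n := fun p => by
      rw [weightJ, norm_mul, norm_e, mul_one, Complex.norm_real,
        Real.norm_of_nonneg (by positivity)]
    simp only [norm_mul, this, norm_e, mapJ, mul_one, ← mul_pow, ← Real.exp_add]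
    ring_nf

/-- In $Z^*=((j\otimes j)Y(j\otimes j))^*Y$ the shifts of $r'$ cancel. Only a shear of $v$ along
$v'$ and a dilation of $v'$ remain, with coefficients depending on $r,r'$; for $\lambda=0$ both are
trivial. -/
theorem exists_isWC_star_opZ : ∃ w : Pt n × Pt n → ℂ, IsWC (star (opZ n lam))
    (fun p => ((p.1.1 + (Real.exp (lam * p.2.2) * Real.exp (lam * -p.1.2) -
      Real.exp (lam * -p.1.2)) • p.2.1, p.1.2), (Real.exp (lam * -p.1.2) • p.2.1, p.2.2))) w ∧
    ∀ p, ‖w p‖ = Real.exp (lam * -p.1.2) ^ n := by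
  obtain ⟨w, hw, hn⟩ := exists_isWC_conjY n lam
  have hw' := (hw.star_of_inverse
    (ψ := fun p => ((p.1.1 - Real.exp (lam * -p.1.2) • p.2.1, p.1.2),
      (Real.exp (lam * -p.1.2) • p.2.1, p.2.2 + p.1.2)))
    (by fun_prop) (fun p => by simp [smul_smul, ← Real.exp_add])
    (fun p h => by
      have := hn p
      rw [h, norm_zero] at this
      exact (pow_pos (Real.exp_pos _) n).ne this)).1
  have hZ : star (opZ n lam) = star (conjY n lam) * opY n lam := by
    rw [opZ, star_mul, star_star, conjY]
  rw [hZ]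
  refine ⟨_, (hw'.mul (isWC_opY n lam)).congr ?_ fun p => rfl, ?_⟩
  · rintro ⟨⟨v, r⟩, ⟨v', r'⟩⟩
    simp [smul_smul, sub_smul]
    abel
  · intro p
    rw [norm_mul, norm_e, norm_inv, hn, mul_one, ← inv_pow, mul_neg, Real.exp_neg]

theorem star_opZ_mul_opZ : star (opZ n lam) * opZ n lam = 1 := by
  obtain ⟨w, hw, -⟩ := exists_isWC_conjY n lam
  change star (star (opY n lam) * conjY n lam) * (star (opY n lam) * conjY n lam) = 1
  rw [star_mul, star_star, mul_assoc, ← mul_assoc (opY n lam), opY_mul_star_opY, one_mul,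
    hw.star_mul_self]

/-- The two halves of the map of $Z^*$ are separately invertible: $(p_2,\varphi_1)$ is a measure
preserving shear after a flip, and $(p_1,\varphi_2)$ a dilation whose Jacobian matches $|w|$. They
give an isometry $F$ and a unitary $R$, and $V=F^*R$. -/
theorem exists_slice_star_opZ : ∃ V : Op (Pt n × Pt n), V * star V = 1 ∧ ∀ g f : L2 (Pt n),
    adjoint (tmulLeft g) ∘L star (opZ n lam) ∘L tmulRight f = hsOp (V (tmul (star g) f)) := by
  obtain ⟨w, hw, hn⟩ := exists_isWC_star_opZ n lam
  have hS : IsWeightedComp (fun p : Pt n × Pt n => (p.1,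
      (p.2.1 + (Real.exp (lam * p.1.2) * Real.exp (lam * -p.2.2) -
        Real.exp (lam * -p.2.2)) • p.1.1, p.2.2))) (fun _ => 1) := by
    have h := isWeightedComp_skew (isWC_one (X := Pt n)).isWeightedComp (Y := Pt n)
      (ψ := fun p => (p.2.1 + (Real.exp (lam * p.1.2) * Real.exp (lam * -p.2.2) -
        Real.exp (lam * -p.2.2)) • p.1.1, p.2.2)) (z := fun _ => 1)
      (by fun_prop) measurable_const fun x f hf => by
        have h := (isWeightedComp_affine n (c := fun _ => 1) measurable_const
          (fun _ => one_ne_zero)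
          (u := fun r => (Real.exp (lam * x.2) * Real.exp (lam * -r) -
            Real.exp (lam * -r)) • x.1) (by fun_prop) (MeasurePreserving.id volume)).lintegral_eq
              f hf
        simpa using h
    simpa using h
  have hR : IsWeightedComp (fun p : Pt n × Pt n =>
      (p.1, (Real.exp (lam * -p.1.2) • p.2.1, p.2.2))) w := by
    have h := isWeightedComp_skew (isWC_one (X := Pt n)).isWeightedComp (Y := Pt n)
      (ψ := fun p => (Real.exp (lam * -p.1.2) • p.2.1, p.2.2))
      (z := fun p => ((|Real.exp (lam * -p.1.2)| ^ n : ℝ) : ℂ))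
      (by fun_prop) (by fun_prop) fun x f hf => by
        have h := (isWeightedComp_affine n (c := fun _ => Real.exp (lam * -x.2)) measurable_const
          (fun _ => (Real.exp_pos _).ne') (u := fun _ => 0) measurable_const
          (MeasurePreserving.id volume)).lintegral_eq f hf
        simpa using h
    -- The phase of $w$ is arbitrary here; its modulus is exactly the dilation factor.
    refine h.congr_weight hw.measurable_weight fun p => ?_
    rw [hn, one_mul, Complex.norm_real, abs_of_pos (Real.exp_pos _),
      Real.norm_of_nonneg (by positivity)]
  obtain ⟨R, hR⟩ : ∃ R, IsWC R _ w := ⟨_, hR.isWC⟩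
  obtain ⟨S, hS⟩ : ∃ S, IsWC S _ _ := ⟨_, hS.isWC⟩
  have hRR := (hR.star_of_inverse
    (ψ := fun p => (p.1, (Real.exp (lam * p.1.2) • p.2.1, p.2.2)))
    (by fun_prop) (fun p => by simp [smul_smul, ← Real.exp_add])
    (fun p h => by
      have := hn p
      rw [h, norm_zero] at this
      exact (pow_pos (Real.exp_pos _) n).ne this)).2
  have hFS := (isWC_flipOp.mul hS).congr (w' := fun _ => 1)
    (φ' := fun p => (p.2, (p.1.1 + (Real.exp (lam * p.2.2) * Real.exp (lam * -p.1.2) -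
      Real.exp (lam * -p.1.2)) • p.2.1, p.1.2))) (fun p => rfl) (fun p => mul_one _)
  refine ⟨_, ?_, slice_eq_hsOp hw hFS hR⟩
  have h := hFS.star_mul_self
  generalize flipOp * S = F at h
  rw [star_mul, star_star, mul_assoc, ← mul_assoc R, hRR, one_mul, h]

theorem algADhat_eq : algADhat n lam = spatialTensor (algA n lam) (algAhatOp n lam) := by
  obtain ⟨V, hV, h⟩ := exists_slice_star_opZ n lam
  rw [algADhat, VD, algA_eq, algAhatOp_eq,
    leftSliceClosure_double _ _ _ V (star_opZ_mul_opZ n lam) hV h]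

end QuantumHeisenberg

end

end QDouble

theorem mainTheorem7 (n : ℕ) (lam : ℝ) :
    QDouble.IsConcreteCStarAlgebra (QDouble.algA n lam) ∧
    QDouble.IsConcreteCStarAlgebra (QDouble.algAhatOp n lam) ∧
    QDouble.IsConcreteCStarAlgebra (QDouble.algADhat n lam) ∧
    QDouble.algADhat n lam =
      QDouble.spatialTensor (QDouble.algA n lam) (QDouble.algAhatOp n lam) := by
  have hA : QDouble.IsConcreteCStarAlgebra (QDouble.algA n lam) := by
    rw [QDouble.algA_eq]
    exact QDouble.isConcreteCStarAlgebra_opX n lam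
  have hB : QDouble.IsConcreteCStarAlgebra (QDouble.algAhatOp n lam) := by
    rw [QDouble.algAhatOp_eq]
    exact QDouble.isConcreteCStarAlgebra_opY n lam
  have h := QDouble.algADhat_eq n lam
  refine ⟨hA, hB, ?_, h⟩
  rw [h]
  exact QDouble.isConcreteCStarAlgebra_spatialTensor hA hB
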